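/- Let $\bar M$ be a smooth manifold of dimension $2n+s$, $s\ge 1$, with a metric $f$-structure $(\varphi,\xi_1,\dots,\xi_s,\eta^1,\dots,\eta^s,g)$: $\varphi$ is a smooth $(1,1)$-tensor field, the $\xi_i$ are smooth vector fields, the $\eta^i$ are smooth $1$-forms and $g$ is a Riemannian metric such that $$\varphi^2=-I+\sum_{i=1}^s\eta^i\otimes\xi_i,\qquad \eta^i(\xi_j)=\delta_{ij},\qquad g(\varphi X,\varphi Y)=g(X,Y)-\sum_{i=1}^s\eta^i(X)\eta^i(Y).$$ Put $\Phi(X,Y)=g(X,\varphi Y)$. Suppose that $\bar M$ is a generalized Kenmotsu manifold, i.e. $\eta^1\wedge\dots\wedge\eta^s\wedge\Phi^n\neq 0$ everywhere, $d\eta^i=0$ for all $i$, $d\Phi=2\sum_{i=1}^s\eta^i\wedge\Phi$, and the structure is normal: $[\varphi,\varphi]+2\sum_{i=1}^s d\eta^i\otimes\xi_i=0$, where $[\varphi,\varphi]$ is the Nijenhuis tensor of $\varphi$. Let $M$ be an (immersed) invariant submanifold of $\bar M$, i.e. $\varphi(T_xM)\subseteq T_xM$ for every $x\in M$ and every $\xi_i$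 is tangent to $M$ along $M$. Give $M$ the induced metric $g$, write $\varphi,\xi_i,\eta^i$ also for the restricted objects on $M$, let $\bar\nabla$ and $\nabla$ be the Levi-Civita connections of $\bar M$ and $M$, and let $h$ be the second fundamental form of $M$, given by the Gauss formula $\bar\nabla_XY=\nabla_XY+h(X,Y)$. Then for all smooth vector fields $X,Y$ tangent to $M$, with $(\nabla_X\varphi)Y=\nabla_X(\varphi Y)-\varphi(\nabla_XY)$, $$(\nabla_X\varphi)Y=\sum_{i=1}^s\{g(\varphi X,Y)\,\xi_i-\eta^i(Y)\,\varphi X\},\qquad h(X,\varphi Y)=\varphi h(X,Y),$$ and moreover $$h(\varphi X,Y)=\varphi h(X,Y),\qquad h(\varphi X,\varphi Y)=-h(X,Y).$$ -/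

import Mathlib

open Bundle Manifold VectorField
open scoped ContDiff Topology

noncomputable section

namespace GenKenmotsu

section Ambient

/-- A metric `f`-structure `(φ, ξ_i, η^i, g)` with `s` structure vector fields on a smooth
manifold `N`. The Riemannian metric `g` is the one carried by the tangent bundle of `N`. -/
structure MetricFStructure (F : Type*) [NormedAddCommGroup F] [NormedSpace ℝ F]
    (N : Type*) [TopologicalSpace N] [ChartedSpace F N] [IsManifold 𝓘(ℝ, F) ∞ N]
    [RiemannianBundle (fun x : N ↦ TangentSpace 𝓘(ℝ, F) x)] (s : ℕ) where
  /-- the tensor field of type `(1,1)` -/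
  φ : (x : N) → TangentSpace 𝓘(ℝ, F) x →L[ℝ] TangentSpace 𝓘(ℝ, F) x
  /-- the structure vector fields -/
  ξ : Fin s → (x : N) → TangentSpace 𝓘(ℝ, F) x
  /-- the structure `1`-forms -/
  η : Fin s → (x : N) → TangentSpace 𝓘(ℝ, F) x →L[ℝ] ℝ
  contMDiff_φ : ContMDiff 𝓘(ℝ, F) (𝓘(ℝ, F).prod 𝓘(ℝ, F →L[ℝ] F)) ∞
    (fun x ↦ TotalSpace.mk' (F →L[ℝ] F)
      (E := fun x : N ↦ TangentSpace 𝓘(ℝ, F) x →L[ℝ] TangentSpace 𝓘(ℝ, F) x) x (φ x))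
  contMDiff_ξ : ∀ i, ContMDiff 𝓘(ℝ, F) (𝓘(ℝ, F).prod 𝓘(ℝ, F)) ∞
    (fun x ↦ TotalSpace.mk' F (E := fun x : N ↦ TangentSpace 𝓘(ℝ, F) x) x (ξ i x))
  contMDiff_η : ∀ i, ContMDiff 𝓘(ℝ, F) (𝓘(ℝ, F).prod 𝓘(ℝ, F →L[ℝ] ℝ)) ∞
    (fun x ↦ TotalSpace.mk' (F →L[ℝ] ℝ)
      (E := fun x : N ↦ TangentSpace 𝓘(ℝ, F) x →L[ℝ] Bundle.Trivial N ℝ x) x (η i x))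
  φ_φ : ∀ (x : N) (v : TangentSpace 𝓘(ℝ, F) x), φ x (φ x v) = -v + ∑ i, η i x v • ξ i x
  η_ξ : ∀ (x : N) (i j : Fin s), η i x (ξ j x) = if i = j then 1 else 0
  inner_φ_φ : ∀ (x : N) (v w : TangentSpace 𝓘(ℝ, F) x),
    inner ℝ (φ x v) (φ x w) = inner ℝ v w - ∑ i, η i x v * η i x w

variable {F : Type*} [NormedAddCommGroup F] [NormedSpace ℝ F]
  {N : Type*} [TopologicalSpace N] [ChartedSpace F N] [IsManifold 𝓘(ℝ, F) ∞ N]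

/-- The vector field `X` is smooth at the point `x`. -/
def SmoothAt (X : (x : N) → TangentSpace 𝓘(ℝ, F) x) (x : N) : Prop :=
  ContMDiffAt 𝓘(ℝ, F) (𝓘(ℝ, F).prod 𝓘(ℝ, F)) ∞
    (fun y ↦ TotalSpace.mk' F (E := fun x : N ↦ TangentSpace 𝓘(ℝ, F) x) y (X y)) x

/-- The derivative `X f` of the function `f` along the vector field `X`, at the point `x`. -/
def dirDeriv (X : (x : N) → TangentSpace 𝓘(ℝ, F) x) (f : N → ℝ) (x : N) : ℝ :=
  mvfderiv 𝓘(ℝ, F) f x (X x)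

/-- The exterior derivative of a `1`-form,
`2 dα(X, Y) = X α(Y) - Y α(X) - α([X, Y])`. -/
def extDerivOneForm (α : (x : N) → TangentSpace 𝓘(ℝ, F) x →L[ℝ] ℝ)
    (X Y : (x : N) → TangentSpace 𝓘(ℝ, F) x) (x : N) : ℝ :=
  (1 / 2 : ℝ) * (dirDeriv X (fun y ↦ α y (Y y)) x - dirDeriv Y (fun y ↦ α y (X y)) x
    - α x (mlieBracket 𝓘(ℝ, F) X Y x))

/-- The exterior derivative of a `2`-form,
`3 dα(X, Y, Z) = 𝔖 (X α(Y, Z) - α([X, Y], Z))`, where `𝔖` is the cyclic sum. -/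
def extDerivTwoForm (α : (x : N) → TangentSpace 𝓘(ℝ, F) x → TangentSpace 𝓘(ℝ, F) x → ℝ)
    (X Y Z : (x : N) → TangentSpace 𝓘(ℝ, F) x) (x : N) : ℝ :=
  (1 / 3 : ℝ) *
    (dirDeriv X (fun y ↦ α y (Y y) (Z y)) x
      + dirDeriv Y (fun y ↦ α y (Z y) (X y)) x
      + dirDeriv Z (fun y ↦ α y (X y) (Y y)) x
      - α x (mlieBracket 𝓘(ℝ, F) X Y x) (Z x)
      - α x (mlieBracket 𝓘(ℝ, F) Y Z x) (X x)
      - α x (mlieBracket 𝓘(ℝ, F) Z X x) (Y x))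

/-- The wedge product of a `1`-form and a `2`-form at a point,
`3 (θ ∧ α)(u, v, w) = θ(u) α(v, w) + θ(v) α(w, u) + θ(w) α(u, v)`
(the same normalization as for the exterior derivatives). -/
def wedgeOneTwo {x : N} (θ : TangentSpace 𝓘(ℝ, F) x → ℝ)
    (α : TangentSpace 𝓘(ℝ, F) x → TangentSpace 𝓘(ℝ, F) x → ℝ)
    (u v w : TangentSpace 𝓘(ℝ, F) x) : ℝ :=
  (1 / 3 : ℝ) * (θ u * α v w + θ v * α w u + θ w * α u v)

/-- The Nijenhuis tensor
`[φ, φ](X, Y) = φ²[X, Y] + [φX, φY] - φ[φX, Y] - φ[X, φY]`. -/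
def nijenhuis (φ : (x : N) → TangentSpace 𝓘(ℝ, F) x →L[ℝ] TangentSpace 𝓘(ℝ, F) x)
    (X Y : (x : N) → TangentSpace 𝓘(ℝ, F) x) (x : N) : TangentSpace 𝓘(ℝ, F) x :=
  φ x (φ x (mlieBracket 𝓘(ℝ, F) X Y x))
    + mlieBracket 𝓘(ℝ, F) (fun y ↦ φ y (X y)) (fun y ↦ φ y (Y y)) x
    - φ x (mlieBracket 𝓘(ℝ, F) (fun y ↦ φ y (X y)) Y x)
    - φ x (mlieBracket 𝓘(ℝ, F) X (fun y ↦ φ y (Y y)) x)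

variable [RiemannianBundle (fun x : N ↦ TangentSpace 𝓘(ℝ, F) x)] {s : ℕ}

namespace MetricFStructure

/-- The fundamental `2`-form `Φ(X, Y) = g(X, φY)`. -/
def Φ (S : MetricFStructure F N s) (x : N) (u v : TangentSpace 𝓘(ℝ, F) x) : ℝ :=
  inner ℝ u (S.φ x v)

/-- The value of `η^1 ∧ … ∧ η^s ∧ Φ^n` at `s + 2n` tangent vectors, up to a positive constant
depending only on `s` and `n`: the alternating sum over all permutations. The vectors are indexed
by `Fin s` (slots of the `η^i`) together with `Fin n × Fin 2` (slots of the `n` factors `Φ`). -/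
def volForm (S : MetricFStructure F N s) (n : ℕ) (x : N)
    (v : Fin s ⊕ (Fin n × Fin 2) → TangentSpace 𝓘(ℝ, F) x) : ℝ :=
  ∑ σ : Equiv.Perm (Fin s ⊕ (Fin n × Fin 2)),
    ((Equiv.Perm.sign σ : ℤ) : ℝ) *
      ((∏ i : Fin s, S.η i x (v (σ (Sum.inl i)))) *
        ∏ j : Fin n, S.Φ x (v (σ (Sum.inr (j, 0)))) (v (σ (Sum.inr (j, 1)))))

/-- The structure is an almost `s`-contact metric structure on a manifold of dimension `2n + s`:
`η^1 ∧ … ∧ η^s ∧ Φ^n` vanishes nowhere. -/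
structure IsAlmostSContact (S : MetricFStructure F N s) (n : ℕ) : Prop where
  finrank_eq : Module.finrank ℝ F = 2 * n + s
  volForm_ne_zero : ∀ x : N, ∃ v, S.volForm n x v ≠ 0

/-- Normality: `[φ, φ] + 2 ∑ dη^i ⊗ ξ_i = 0`. -/
def IsNormal (S : MetricFStructure F N s) : Prop :=
  ∀ (x : N) (X Y : (x : N) → TangentSpace 𝓘(ℝ, F) x), SmoothAt X x → SmoothAt Y x →
    nijenhuis S.φ X Y x + (2 : ℝ) • ∑ i, extDerivOneForm (S.η i) X Y x • S.ξ i x = 0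

/-- A generalized almost Kenmotsu structure on a manifold of dimension `2n + s`, `s ≥ 1`:
an almost `s`-contact metric structure with `dη^i = 0` for all `i` and `dΦ = 2 ∑ η^i ∧ Φ`. -/
structure IsGeneralizedAlmostKenmotsu (S : MetricFStructure F N s) (n : ℕ) : Prop where
  one_le : 1 ≤ s
  almostSContact : S.IsAlmostSContact n
  dη_eq_zero : ∀ (i : Fin s) (x : N) (X Y : (x : N) → TangentSpace 𝓘(ℝ, F) x),
    SmoothAt X x → SmoothAt Y x → extDerivOneForm (S.η i) X Y x = 0
  dΦ_eq : ∀ (x : N) (X Y Z : (x : N) → TangentSpace 𝓘(ℝ, F) x),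
    SmoothAt X x → SmoothAt Y x → SmoothAt Z x →
    extDerivTwoForm S.Φ X Y Z x =
      2 * ∑ i, wedgeOneTwo (fun u ↦ S.η i x u) (S.Φ x) (X x) (Y x) (Z x)

/-- A generalized Kenmotsu structure: a normal generalized almost Kenmotsu structure. -/
structure IsGeneralizedKenmotsu (S : MetricFStructure F N s) (n : ℕ) : Prop where
  almost : S.IsGeneralizedAlmostKenmotsu n
  normal : S.IsNormal

end MetricFStructure

/-- The connection `cov` on the tangent bundle is the Levi-Civita connection of the Riemannian
metric: it is torsion-free and compatible with the metric. -/
structure IsLeviCivita [FiniteDimensional ℝ F]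
    [IsContMDiffRiemannianBundle 𝓘(ℝ, F) ∞ F (fun x : N ↦ TangentSpace 𝓘(ℝ, F) x)]
    (cov : CovariantDerivative 𝓘(ℝ, F) F (fun x : N ↦ TangentSpace 𝓘(ℝ, F) x)) : Prop where
  torsion_eq_zero : cov.torsion = 0
  metric : @CovariantDerivative.IsMetricCompatible F _ _ F _ 𝓘(ℝ, F) N _ _ F _ _
    (fun x : N ↦ TangentSpace 𝓘(ℝ, F) x) _ inferInstance inferInstance _ cov _ _ _ _

end Ambient

section Submanifold

variable {E : Type*} [NormedAddCommGroup E] [NormedSpace ℝ E]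
  {M : Type*} [TopologicalSpace M] [ChartedSpace E M]
  {F : Type*} [NormedAddCommGroup F] [NormedSpace ℝ F]
  {N : Type*} [TopologicalSpace N] [ChartedSpace F N] [IsManifold 𝓘(ℝ, F) ∞ N]

/-- The covariant derivative `∇_u V` at `p`, in the direction `u ∈ T_p M`, of a vector field `V`
along the map `f : M → N`, i.e. `V q ∈ T_{f q} N`, for the connection induced on `f^* TN` by the
connection `cov` on `TN`. If `E_k` is the frame of `TN` near `f p` coming from the preferred
trivialization at `f p` and `V = ∑ c^k (E_k ∘ f)`, this is
`∑ dc^k(u) E_k (f p) + ∑ c^k(p) (∇_{df u} E_k) (f p)`. If `V` extends to a vector field `W` of `N`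
near `f p`, it is `∇_{df u} W`, see `covDerivAlong_comp`. -/
def covDerivAlong (cov : CovariantDerivative 𝓘(ℝ, F) F (fun x : N ↦ TangentSpace 𝓘(ℝ, F) x))
    (f : M → N) (V : (q : M) → TangentSpace 𝓘(ℝ, F) (f q)) (p : M)
    (u : TangentSpace 𝓘(ℝ, E) p) : TangentSpace 𝓘(ℝ, F) (f p) :=
  let e := trivializationAt F (fun x : N ↦ TangentSpace 𝓘(ℝ, F) x) (f p)
  let c : M → F := fun q ↦ (e (TotalSpace.mk' F (f q) (V q))).2
  e.symm (f p) (mvfderiv 𝓘(ℝ, E) c p u)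
    + cov (fun y ↦ e.symm y (c p)) (f p) (mfderiv 𝓘(ℝ, E) 𝓘(ℝ, F) f p u)

/-- Along `f`, the induced covariant derivative of the restriction of a vector field
`W` of the ambient manifold is the ambient covariant derivative of `W`. -/
theorem covDerivAlong_comp [FiniteDimensional ℝ F]
    (cov : CovariantDerivative 𝓘(ℝ, F) F (fun x : N ↦ TangentSpace 𝓘(ℝ, F) x))
    {f : M → N} {p : M} (hf : MDifferentiableAt 𝓘(ℝ, E) 𝓘(ℝ, F) f p)
    (W : (x : N) → TangentSpace 𝓘(ℝ, F) x)
    (hW : MDifferentiableAt 𝓘(ℝ, F) (𝓘(ℝ, F).prod 𝓘(ℝ, F))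
      (fun y ↦ TotalSpace.mk' F (E := fun x : N ↦ TangentSpace 𝓘(ℝ, F) x) y (W y)) (f p))
    (V : (q : M) → TangentSpace 𝓘(ℝ, F) (f q)) (hV : ∀ᶠ q in 𝓝 p, V q = W (f q))
    (u : TangentSpace 𝓘(ℝ, E) p) :
    covDerivAlong cov f V p u = cov W (f p) (mfderiv 𝓘(ℝ, E) 𝓘(ℝ, F) f p u) := by
  classical
  set e := trivializationAt F (fun x : N ↦ TangentSpace 𝓘(ℝ, F) x) (f p) with he
  have hp : f p ∈ e.baseSet := FiberBundle.mem_baseSet_trivializationAt' (f p)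
  set d : N → F := fun y ↦ (e (TotalSpace.mk' F y (W y))).2 with hd
  have hdiff : MDifferentiableAt 𝓘(ℝ, F) 𝓘(ℝ, F) d (f p) :=
    (mdifferentiableAt_section 𝓘(ℝ, F) W).1 hW
  let b := Module.finBasis ℝ F
  let L : Fin (Module.finrank ℝ F) → F →L[ℝ] ℝ := fun k ↦ LinearMap.toContinuousLinearMap (b.coord k)
  let g : Fin (Module.finrank ℝ F) → N → ℝ := fun k ↦ L k ∘ d
  let Z : Fin (Module.finrank ℝ F) → (x : N) → TangentSpace 𝓘(ℝ, F) x := fun k y ↦ e.symm y (b k)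
  have hZ : ∀ k, MDifferentiableAt 𝓘(ℝ, F) (𝓘(ℝ, F).prod 𝓘(ℝ, F))
      (fun y ↦ TotalSpace.mk' F (E := fun x : N ↦ TangentSpace 𝓘(ℝ, F) x) y (Z k y)) (f p) := by
    intro k
    have := FiberBundle.mdifferentiableAt_extend 𝓘(ℝ, F) F
      (V := fun x : N ↦ TangentSpace 𝓘(ℝ, F) x) (e.symm (f p) (b k))
    simpa [FiberBundle.extend, Z, ← he, e.apply_mk_symm hp] using this
  have hsum : ∀ y ∈ e.baseSet, ∀ v : F, e.symm y v = ∑ k, L k v • e.symm y (b k) := by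
    intro y hy v
    conv_lhs => rw [← b.sum_equivFun v]
    simp only [← e.symmₗ_apply (R := ℝ) hy, map_sum, map_smul]
    simp [L]
  have hg : ∀ k, HasMFDerivAt 𝓘(ℝ, F) 𝓘(ℝ, ℝ) (g k) (f p)
      ((L k).comp (mfderiv 𝓘(ℝ, F) 𝓘(ℝ, F) d (f p))) := fun k ↦
    (L k).hasMFDerivAt.comp (f p) hdiff.hasMFDerivAt
  have hgs : ∀ (a : Fin (Module.finrank ℝ F) → N → ℝ)
      (_ : ∀ k, MDifferentiableAt 𝓘(ℝ, F) 𝓘(ℝ, ℝ) (a k) (f p))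
      (t : Finset (Fin (Module.finrank ℝ F))),
      MDifferentiableAt 𝓘(ℝ, F) (𝓘(ℝ, F).prod 𝓘(ℝ, F))
        (fun y ↦ TotalSpace.mk' F (E := fun x : N ↦ TangentSpace 𝓘(ℝ, F) x) y
          ((∑ k ∈ t, a k • Z k) y)) (f p) ∧
      cov (∑ k ∈ t, a k • Z k) (f p) = ∑ k ∈ t, (a k (f p) • cov (Z k) (f p) +
        (mvfderiv 𝓘(ℝ, F) (a k) (f p)).smulRight (Z k (f p))) := by
    intro a ha t
    induction t using Finset.induction_on with
    | empty => 
      simp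
      exact mdifferentiableAt_zeroSection ..
    | insert k t hk ih =>
      have h1 := (ha k).smul_section (hZ k)
      rw [Finset.sum_insert hk, Finset.sum_insert hk]
      refine ⟨mdifferentiableAt_add_section h1 ih.1, ?_⟩
      rw [cov.isCovariantDerivativeOnUniv.add h1 ih.1, ih.2,
        cov.isCovariantDerivativeOnUniv.leibniz (hZ k) (ha k)]
  have hnhds : ∀ᶠ y in 𝓝 (f p), y ∈ e.baseSet := e.open_baseSet.mem_nhds hp
  have hc : (fun q ↦ (e (TotalSpace.mk' F (f q) (V q))).2) =ᶠ[𝓝 p] d ∘ f := by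
    filter_upwards [hV] with q hq
    simp [hd, hq]
  have hcp : (e (TotalSpace.mk' F (f p) (V p))).2 = d (f p) := hc.self_of_nhds
  have hder : mfderiv 𝓘(ℝ, E) 𝓘(ℝ, F) (fun q ↦ (e (TotalSpace.mk' F (f q) (V q))).2) p =
      (mfderiv 𝓘(ℝ, F) 𝓘(ℝ, F) d (f p)).comp (mfderiv 𝓘(ℝ, E) 𝓘(ℝ, F) f p) :=
    ((hdiff.hasMFDerivAt.comp p hf.hasMFDerivAt).congr_of_eventuallyEq hc).mfderiv
  have hW' : ∀ᶠ y in 𝓝 (f p), W y = (∑ k, g k • Z k) y := by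
    filter_upwards [hnhds] with y hy
    have := hsum y hy (d y)
    rw [hd, e.symm_apply_apply_mk hy] at this
    simpa [g, Z] using this
  obtain ⟨h1, h2⟩ := hgs g (fun k ↦ (hg k).mdifferentiableAt) Finset.univ
  obtain ⟨h3, h4⟩ := hgs (fun k _ ↦ L k (d (f p))) (fun k ↦ mdifferentiableAt_const) Finset.univ
  have hC' : ∀ᶠ y in 𝓝 (f p), e.symm y (d (f p)) = (∑ k, (fun _ ↦ L k (d (f p)) : N → ℝ) • Z k) y := by
    filter_upwards [hnhds] with y hy
    simpa [Z] using hsum y hy (d (f p))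
  have hC : MDifferentiableAt 𝓘(ℝ, F) (𝓘(ℝ, F).prod 𝓘(ℝ, F))
      (fun y ↦ TotalSpace.mk' F (E := fun x : N ↦ TangentSpace 𝓘(ℝ, F) x) y
        (e.symm y (d (f p)))) (f p) := by
    refine h3.congr_of_eventuallyEq ?_
    filter_upwards [hC'] with y hy
    rw [hy]
  have e1 := cov.isCovariantDerivativeOnUniv.congr_of_eventuallyEq hW h1 Filter.univ_mem hW'
  have e2 := cov.isCovariantDerivativeOnUniv.congr_of_eventuallyEq hC h3 Filter.univ_mem hC'
  simp only [covDerivAlong]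
  rw [← he, hcp, e1, h2, e2, h4, mvfderiv, hder]
  simp only [mvfderiv_const]
  set w := mfderiv 𝓘(ℝ, E) 𝓘(ℝ, F) f p u with hw
  have h5 := hsum (f p) hp (mfderiv 𝓘(ℝ, F) 𝓘(ℝ, F) d (f p) w)
  have h6 : ∀ k, mvfderiv 𝓘(ℝ, F) (g k) (f p) w = L k (mfderiv 𝓘(ℝ, F) 𝓘(ℝ, F) d (f p) w) := by
    intro k
    rw [mvfderiv, (hg k).mfderiv]
    rfl
  simp only [sum_apply, add_apply, h6,
    smul_apply, ContinuousLinearMap.smulRight_apply, Finset.sum_add_distrib,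
    zero_apply, zero_smul, Finset.sum_const_zero, add_zero]
  rw [add_comm]
  congr 1

variable [RiemannianBundle (fun x : N ↦ TangentSpace 𝓘(ℝ, F) x)] {s : ℕ}

/-- `f : M → N` is an isometric immersion: it is smooth and the metric of `M` is the metric induced
by `f` (so `df` is injective). This makes `M` a submanifold of `N` with the induced metric. -/
structure IsIsometricImmersion [RiemannianBundle (fun p : M ↦ TangentSpace 𝓘(ℝ, E) p)]
    (f : M → N) : Prop where
  contMDiff : ContMDiff 𝓘(ℝ, E) 𝓘(ℝ, F) ∞ f
  inner_mfderiv : ∀ (p : M) (u v : TangentSpace 𝓘(ℝ, E) p),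
    inner ℝ (mfderiv 𝓘(ℝ, E) 𝓘(ℝ, F) f p u) (mfderiv 𝓘(ℝ, E) 𝓘(ℝ, F) f p v) = inner ℝ u v

/-- `M`, immersed in `N` by `f`, is an invariant submanifold: `φ(T_x M) ⊆ T_x M` for every point
`x` of `M`, and all `ξ_i` are tangent to `M`. -/
structure IsInvariantSubmanifold (S : MetricFStructure F N s) (f : M → N) : Prop where
  φ_mem : ∀ (p : M) (u : TangentSpace 𝓘(ℝ, E) p),
    S.φ (f p) (mfderiv 𝓘(ℝ, E) 𝓘(ℝ, F) f p u) ∈ Set.range (mfderiv 𝓘(ℝ, E) 𝓘(ℝ, F) f p)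
  ξ_mem : ∀ (i : Fin s) (p : M), S.ξ i (f p) ∈ Set.range (mfderiv 𝓘(ℝ, E) 𝓘(ℝ, F) f p)

/-- The tangent vector of `M` at `p` which `df` maps to `w`, if there is one. -/
def tangentPreimage (f : M → N) (p : M) (w : TangentSpace 𝓘(ℝ, F) (f p)) :
    TangentSpace 𝓘(ℝ, E) p :=
  Function.invFun (mfderiv 𝓘(ℝ, E) 𝓘(ℝ, F) f p) w

/-- The restriction of `φ` to the tangent spaces of an invariant submanifold. -/
def inducedφ (S : MetricFStructure F N s) (f : M → N) (p : M) (u : TangentSpace 𝓘(ℝ, E) p) :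
    TangentSpace 𝓘(ℝ, E) p :=
  tangentPreimage f p (S.φ (f p) (mfderiv 𝓘(ℝ, E) 𝓘(ℝ, F) f p u))

theorem mfderiv_inducedφ {S : MetricFStructure F N s} {f : M → N}
    (h : IsInvariantSubmanifold (E := E) S f) (p : M) (u : TangentSpace 𝓘(ℝ, E) p) :
    mfderiv 𝓘(ℝ, E) 𝓘(ℝ, F) f p (inducedφ S f p u)
      = S.φ (f p) (mfderiv 𝓘(ℝ, E) 𝓘(ℝ, F) f p u) :=
  Function.invFun_eq (h.φ_mem p u)

/-- The structure vector fields `ξ_i`, as vector fields on an invariant submanifold. -/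
def inducedξ (S : MetricFStructure F N s) (f : M → N) (i : Fin s) (p : M) :
    TangentSpace 𝓘(ℝ, E) p :=
  tangentPreimage f p (S.ξ i (f p))

theorem mfderiv_inducedξ {S : MetricFStructure F N s} {f : M → N}
    (h : IsInvariantSubmanifold (E := E) S f) (i : Fin s) (p : M) :
    mfderiv 𝓘(ℝ, E) 𝓘(ℝ, F) f p (inducedξ S f i p) = S.ξ i (f p) :=
  Function.invFun_eq (h.ξ_mem i p)

/-- The restrictions to `M` of the structure `1`-forms `η^i`. -/
def inducedη (S : MetricFStructure F N s) (f : M → N) (i : Fin s) (p : M)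
    (u : TangentSpace 𝓘(ℝ, E) p) : ℝ :=
  S.η i (f p) (mfderiv 𝓘(ℝ, E) 𝓘(ℝ, F) f p u)

/-- The vector field `φY` on `M`, for a vector field `Y` on `M`. -/
def inducedφField (S : MetricFStructure F N s) (f : M → N)
    (Y : (p : M) → TangentSpace 𝓘(ℝ, E) p) (p : M) : TangentSpace 𝓘(ℝ, E) p :=
  inducedφ S f p (Y p)

variable [IsManifold 𝓘(ℝ, E) ∞ M]

/-- The covariant derivative `(∇_X φ) Y = ∇_X (φY) - φ (∇_X Y)` of the induced `φ` on `M`. -/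
def covDerivφ (S : MetricFStructure F N s) (f : M → N)
    (cov : CovariantDerivative 𝓘(ℝ, E) E (fun p : M ↦ TangentSpace 𝓘(ℝ, E) p))
    (X Y : (p : M) → TangentSpace 𝓘(ℝ, E) p) (p : M) : TangentSpace 𝓘(ℝ, E) p :=
  cov (inducedφField S f Y) p (X p) - inducedφ S f p (cov Y p (X p))

/-- The second fundamental form, by the Gauss formula `h(X, Y) = ∇̄_X Y - ∇_X Y`, where `covN` is
the connection `∇̄` of the ambient manifold and `covM` is the connection `∇` of the submanifold. -/
def secondFundamentalForm
    (covN : CovariantDerivative 𝓘(ℝ, F) F (fun x : N ↦ TangentSpace 𝓘(ℝ, F) x))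
    (covM : CovariantDerivative 𝓘(ℝ, E) E (fun p : M ↦ TangentSpace 𝓘(ℝ, E) p)) (f : M → N)
    (X Y : (p : M) → TangentSpace 𝓘(ℝ, E) p) (p : M) : TangentSpace 𝓘(ℝ, F) (f p) :=
  covDerivAlong covN f (fun q ↦ mfderiv 𝓘(ℝ, E) 𝓘(ℝ, F) f q (Y q)) p (X p)
    - mfderiv 𝓘(ℝ, E) 𝓘(ℝ, F) f p (covM Y p (X p))

end Submanifold

end GenKenmotsu

end

open GenKenmotsu

/-! On the ambient manifold `(∇̄_X φ)Y` is given by the same formula as the one claimed on `M`.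
Substituting it into `∇̄_X(φY) = (∇̄_X φ)Y + φ ∇̄_X Y` and using the Gauss formula on both sides,
the tangential part is the formula for `∇φ` and the normal part is `h(X, φY) = φ h(X, Y)`. The split
works because `φ` preserves the tangent spaces of `M` and, being skew, also their orthogonal
complements. Symmetry of `h` then gives `h(φX, Y) = φ h(X, Y)`, and `h(φX, φY) = φ² h(X, Y) = -h(X,
Y)` since `h` is orthogonal to the tangent fields `ξ_i`.

The ambient formula is `nablaφ_eq`. At one point, the tensors `∇̄φ` and `∇̄ξ_i` satisfy a linear
system: `dη^i = 0` makes `∇̄ξ_i` symmetric, `dΦ` prescribes a cyclic sum, normality gives a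
Nijenhuis identity, and differentiating the skewness of `φ`, the formula for `φ²` and `φ ξ_i = 0`
gives the rest. The expected values solve the system, and the homogeneous system has only the zero
solution (`structureEquations_unique`). Skewness of `φ` and `φ ξ_i = 0` do not follow from the
pointwise axioms when `s ≥ 2`, as `φ` could be nilpotent on the span of the `ξ_i`; they are
extracted from the equation for `dΦ` (`Φ_skew`).

Since `M` is only immersed, `∇̄` acts on vector fields along `f`. Leibniz rules and metric
compatibility pass to this induced connection because such fields are locally combinations of
restrictions of ambient fields (`MDiffAlongAt.induction`); torsion-freeness is checked in a chart
(`covDerivAlong_sub`). As `h` is defined as a difference of connections, its normality is a theorem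
(`inner_secondFundamentalForm_mfderiv`). -/

noncomputable section

namespace GenKenmotsu

/-! ### Linear algebra of the structure equations at a point. -/

section Algebra

variable {V : Type*} [AddCommGroup V] [Module ℝ V] {s : ℕ}

theorem _root_.IsLinearMap.apply_φ_φ {φ : V → V} {ξ : Fin s → V} {η : Fin s → V → ℝ}
    (hφ : ∀ v, φ (φ v) = -v + ∑ i, η i v • ξ i) {l : V → ℝ} (hl : IsLinearMap ℝ l) (v : V) :
    l (φ (φ v)) = -l v + ∑ i, η i v * l (ξ i) := by
  have := map_sum hl.mk' (fun i ↦ η i v • ξ i) Finset.univ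
  simp only [IsLinearMap.mk'_apply, hl.map_smul, smul_eq_mul] at this
  rw [hφ, hl.map_add, hl.map_neg, this]

/-- The homogeneous linear system satisfied by the difference of two solutions of the structure
equations of a generalized Kenmotsu manifold has only the trivial solution: here `D X Y Z` stands
for `g((∇_X φ) Y, Z)` and `b i X Y` for `g(∇_X ξ_i, Y)`. -/
theorem structureEquations_unique {φ : V → V} {ξ : Fin s → V} {η : Fin s → V → ℝ}
    (hφ : ∀ v, φ (φ v) = -v + ∑ i, η i v • ξ i)
    (hηξ : ∀ i j, η i (ξ j) = if i = j then 1 else 0)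
    (hφξ : ∀ i, φ (ξ i) = 0)
    {D : V → V → V → ℝ} {b : Fin s → V → V → ℝ}
    (hD₁ : ∀ Y Z, IsLinearMap ℝ (fun X ↦ D X Y Z)) (hD₃ : ∀ X Y, IsLinearMap ℝ (D X Y))
    (hb : ∀ i X, IsLinearMap ℝ (b i X))
    (b_symm : ∀ i X Y, b i X Y = b i Y X)
    (skew : ∀ X Y Z, D X Y Z = -D X Z Y)
    (cyc : ∀ X Y Z, D X Y Z + D Y Z X + D Z X Y = 0)
    (nij : ∀ X Y Z, D (φ X) Y Z - D (φ Y) X Z + D X Y (φ Z) - D Y X (φ Z) = 0)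
    (comm : ∀ X Y Z, D X (φ Y) Z - D X Y (φ Z) =
      ∑ i, (b i X Y * η i Z + η i Y * b i X Z))
    (hDξ : ∀ i X Z, D X (ξ i) Z = b i X (φ Z)) (X Y Z : V) :
    D X Y Z = 0 ∧ ∀ i, b i X Y = 0 := by
  have D_zero (X Y) : D X Y 0 = 0 := (hD₃ X Y).map_zero
  have D_zero' (X Z) : D X 0 Z = 0 := by rw [skew, D_zero, neg_zero]
  have b_zero (i X) : b i X 0 = 0 := (hb i X).map_zero
  -- Evaluating `comm` on two structure vectors kills its left side, because `φ ξ_i = 0`.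
  have b_anti (i j X) : b i X (ξ j) = -b j X (ξ i) := by
    have h := comm X (ξ j) (ξ i)
    simp only [hφξ, D_zero, D_zero', sub_zero, hηξ, Finset.sum_add_distrib, mul_ite, ite_mul,
      mul_one, mul_zero, one_mul, zero_mul, Finset.sum_ite_eq', Finset.mem_univ, if_true] at h
    linarith
  -- Symmetric under exchange of `j, k` and skew under exchange of `i, k`, hence zero.
  have b_ξξ (i j k) : b i (ξ j) (ξ k) = 0 := by
    have h1 := b_anti i k (ξ j)
    have h2 := b_symm k (ξ j) (ξ i)
    have h3 := b_anti k j (ξ i)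
    have h4 := b_symm j (ξ i) (ξ k)
    have h5 := b_anti j i (ξ k)
    have h6 := b_symm i (ξ k) (ξ j)
    linarith
  -- On two structure vectors `nij` says that this is symmetric in `i, j`, while `b_anti` says that
  -- it is skew.
  have b_ξ' (i j Z) : b i (ξ j) Z = 0 := by
    have h := nij (ξ i) (ξ j) Z
    simp only [hφξ, (hD₁ _ _).map_zero, hDξ, (hb _ _).apply_φ_φ hφ, b_ξξ, mul_zero,
      Finset.sum_const_zero] at h
    have h1 := b_symm i (ξ j) Z
    have h2 := b_anti i j Z
    have h3 := b_symm j (ξ i) Z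
    linarith
  have b_ξ (i X j) : b i X (ξ j) = 0 := by rw [b_symm, b_ξ']
  have b_φφ (i X Z) : b i X (φ (φ Z)) = -b i X Z := by
    simp [(hb _ _).apply_φ_φ hφ, b_ξ]
  have b_φφ' (i X Z) : b i (φ (φ X)) Z = -b i X Z := by
    rw [b_symm, b_φφ, b_symm]
  have D_ξ_φ (i X Z) : D (ξ i) X (φ Z) = -b i X Z - b i (φ X) (φ Z) := by
    have h := cyc (ξ i) X (φ Z)
    have h1 := skew X (φ Z) (ξ i)
    have h2 := b_symm i (φ Z) (φ X)
    rw [hDξ, b_φφ] at h1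
    rw [hDξ] at h
    linarith
  -- In `nij` at `(X, ξ_i, Z)` the terms `b i X Z` cancel and `2 b i (φ X) (φ Z)` remains.
  have b_φ_φ (i X Z) : b i (φ X) (φ Z) = 0 := by
    have h := nij X (ξ i) Z
    simp only [hφξ, (hD₁ _ _).map_zero, hDξ, b_φφ, D_ξ_φ] at h
    linarith
  -- Up to multiples of the `ξ_j`, on which `b` vanishes, `φ²` is `-1`, so every vector may be taken
  -- in the image of `φ`.
  have b_eq (i X Z) : b i X Z = 0 := by
    have h := b_φ_φ i (φ X) (φ Z)
    rw [b_φφ, b_φφ'] at h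
    linarith
  have D_ξ₂ (i X Z) : D X (ξ i) Z = 0 := by rw [hDξ, b_eq]
  have D_ξ₃ (i X Z) : D X Z (ξ i) = 0 := by rw [skew, D_ξ₂, neg_zero]
  have D_comm (X Y Z) : D X (φ Y) Z = D X Y (φ Z) := by
    have h := comm X Y Z
    simp only [b_eq, mul_zero, zero_mul, add_zero, Finset.sum_const_zero] at h
    linarith
  have D_ξ₁ (i X Z) : D (ξ i) X Z = 0 := by
    have h := D_ξ_φ i X (φ Z)
    simp only [b_eq, (hD₃ _ _).apply_φ_φ hφ, D_ξ₃, mul_zero, Finset.sum_const_zero] at h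
    linarith
  -- The cyclic identity turns the last two terms of `nij` into `-D (φ Z) X Y`. The sum of two of
  -- the three cyclic permutations of the result is twice a single term.
  have key (X Y Z) : D (φ X) Y Z + D (φ Y) Z X - D (φ Z) X Y = 0 := by
    have h1 := nij X Y Z
    have h2 := cyc X Y (φ Z)
    have h3 := skew Y (φ Z) X
    have h4 := skew (φ Y) X Z
    linarith
  have D_φ (X Y Z) : D (φ X) Y Z = 0 := by
    have h1 := key X Y Z
    have h2 := key Y Z X
    have h3 := key Z X Y
    linarith
  have h := D_φ (φ X) Y Z
  rw [(hD₁ Y Z).apply_φ_φ hφ] at h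
  simp only [D_ξ₁, mul_zero, Finset.sum_const_zero] at h
  exact ⟨by linarith, fun i ↦ b_eq i X Y⟩

/-- The structure equations of a generalized Kenmotsu manifold at a point determine `∇ φ`: here
`A Y X` stands for `(∇_X φ) Y` and `C i X` for `∇_X ξ_i`. -/
theorem structureEquations_solution {V : Type*} [NormedAddCommGroup V] [InnerProductSpace ℝ V]
    {s : ℕ} {φ : V →L[ℝ] V} {ξ : Fin s → V} {η : Fin s → V →L[ℝ] ℝ}
    (hφ : ∀ v, φ (φ v) = -v + ∑ i, η i v • ξ i)
    (hηξ : ∀ i j, η i (ξ j) = if i = j then 1 else 0)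
    (hφξ : ∀ i, φ (ξ i) = 0) (hηφ : ∀ i v, η i (φ v) = 0)
    (inner_ξ : ∀ i v, inner ℝ v (ξ i) = η i v)
    (φ_skew : ∀ v w, inner ℝ (φ v) w = -inner ℝ v (φ w))
    {A : V →L[ℝ] V →L[ℝ] V} {C : Fin s → V →L[ℝ] V}
    (C_symm : ∀ i X Y, inner ℝ (C i X) Y = inner ℝ (C i Y) X)
    (skew : ∀ X Y Z, inner ℝ (A Y X) Z = -inner ℝ Y (A Z X))
    (cyc : ∀ X Y Z, inner ℝ (A Y X) Z + inner ℝ (A Z Y) X + inner ℝ (A X Z) Y =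
      2 * ∑ i, (η i X * inner ℝ (φ Y) Z + η i Y * inner ℝ (φ Z) X + η i Z * inner ℝ (φ X) Y))
    (nij : ∀ X Y, A Y (φ X) - A X (φ Y) - φ (A Y X) + φ (A X Y) = 0)
    (comm : ∀ X Y, A (φ Y) X + φ (A Y X) = ∑ i, (inner ℝ (C i X) Y • ξ i + η i Y • C i X))
    (hAξ : ∀ i X, A (ξ i) X = -φ (C i X)) (X Y : V) :
    A Y X = ∑ i, (inner ℝ (φ X) Y • ξ i - η i Y • φ X) := by
  have ξ_inner (i v) : inner ℝ (ξ i) v = η i v := by rw [real_inner_comm, inner_ξ]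
  have φφ_inner (v w) : inner ℝ (φ (φ v)) w = -inner ℝ v w + ∑ i, η i v * η i w := by
    simp [hφ, inner_add_left, sum_inner, inner_smul_left, ξ_inner]
  have sk (X Y) : inner ℝ (φ X) Y = - inner ℝ (φ Y) X := by rw [φ_skew, real_inner_comm]
  let D : V → V → V → ℝ := fun X Y Z ↦ inner ℝ (A Y X) Z -
    ∑ i, (inner ℝ (φ X) Y * η i Z - η i Y * inner ℝ (φ X) Z)
  -- The particular solution has `∇_X ξ_i = -φ² X` for every `i`; paired with `Y` this is `g(φX,
  -- φY)`, as `φ` is skew.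
  let b : Fin s → V → V → ℝ := fun i X Y ↦ inner ℝ (C i X) Y - inner ℝ (φ X) (φ Y)
  have main (Z : V) : D X Y Z = 0 := by
    refine (structureEquations_unique (φ := φ) (η := fun i ↦ η i) hφ hηξ hφξ (D := D) (b := b)
      ?_ ?_ ?_ ?_ ?_ ?_ ?_ ?_ ?_ X Y Z).1
    · intro Y Z
      constructor
      · intro u v
        simp only [D, map_add, inner_add_left, add_mul, mul_add, Finset.sum_sub_distrib,
          Finset.sum_add_distrib]
        ring
      · intro c u
        simp only [D, map_smul, inner_smul_left, smul_eq_mul, mul_sub, Finset.mul_sum]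
        congr 1
        refine Finset.sum_congr rfl fun i _ ↦ ?_
        simp
        ring
    · intro Y Z
      constructor
      · intro u v
        simp only [D, map_add, inner_add_right, mul_add, Finset.sum_sub_distrib,
          Finset.sum_add_distrib]
        ring
      · intro c u
        simp only [D, map_smul, inner_smul_right, smul_eq_mul, mul_sub, Finset.mul_sum]
        congr 1
        refine Finset.sum_congr rfl fun i _ ↦ ?_
        ring
    · intro i X
      constructor
      · intro u v
        simp only [b, map_add, inner_add_right]
        ring
      · intro c u
        simp only [b, map_smul, inner_smul_right, smul_eq_mul, mul_sub]
    · intro i X Y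
      simp only [b]
      rw [C_symm, real_inner_comm (φ X)]
    · intro X Y Z
      simp only [D]
      rw [skew, real_inner_comm, neg_sub, sub_eq_add_neg, add_comm, ← Finset.sum_neg_distrib,
        sub_eq_add_neg]
      congr 1
      refine Finset.sum_congr rfl fun i _ ↦ ?_
      ring
    · intro X Y Z
      have h := cyc X Y Z
      rw [Finset.mul_sum] at h
      have e : inner ℝ (A Y X) Z + inner ℝ (A Z Y) X + inner ℝ (A X Z) Y =
          ∑ i, ((inner ℝ (φ X) Y * η i Z - η i Y * inner ℝ (φ X) Z) +
            (inner ℝ (φ Y) Z * η i X - η i Z * inner ℝ (φ Y) X) +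
            (inner ℝ (φ Z) X * η i Y - η i X * inner ℝ (φ Z) Y)) := by
        rw [h]
        refine Finset.sum_congr rfl fun i _ ↦ ?_
        rw [sk Y X, sk Z Y, sk X Z]
        ring
      simp only [Finset.sum_add_distrib] at e
      simp only [D]
      linarith
    · intro X Y Z
      have h := congrArg (inner ℝ · Z) (nij X Y)
      simp only [inner_add_left, inner_sub_left, inner_zero_left, φ_skew] at h
      have e : ∑ i, (inner ℝ (φ (φ X)) Y * η i Z - η i Y * inner ℝ (φ (φ X)) Z)
          - ∑ i, (inner ℝ (φ (φ Y)) X * η i Z - η i X * inner ℝ (φ (φ Y)) Z)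
          + ∑ i, (inner ℝ (φ X) Y * η i (φ Z) - η i Y * inner ℝ (φ X) (φ Z))
          - ∑ i, (inner ℝ (φ Y) X * η i (φ Z) - η i X * inner ℝ (φ Y) (φ Z)) = 0 := by
        rw [← Finset.sum_sub_distrib, ← Finset.sum_add_distrib, ← Finset.sum_sub_distrib]
        refine Finset.sum_eq_zero fun i _ ↦ ?_
        rw [φ_skew (φ X) Y, φ_skew (φ Y) X, φ_skew (φ X) Z, φ_skew (φ Y) Z, hηφ,
          real_inner_comm (φ X)]
        ring
      simp only [D]
      linarith
    · intro X Y Z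
      have h := congrArg (inner ℝ · Z) (comm X Y)
      simp only [inner_add_left, sum_inner, inner_smul_left, ξ_inner, φ_skew (A Y X)] at h
      simp only [D, b]
      have e : ∑ i, (inner ℝ (φ X) (φ Y) * η i Z - η i (φ Y) * inner ℝ (φ X) Z)
          - ∑ i, (inner ℝ (φ X) Y * η i (φ Z) - η i Y * inner ℝ (φ X) (φ Z))
          = ∑ i, (inner ℝ (φ X) (φ Y) * η i Z + η i Y * inner ℝ (φ X) (φ Z)) := by
        rw [← Finset.sum_sub_distrib]
        refine Finset.sum_congr rfl fun i _ ↦ ?_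
        rw [hηφ, hηφ]
        ring
      have e' : ∑ i, ((inner ℝ (C i X) Y - inner ℝ (φ X) (φ Y)) * η i Z +
            η i Y * (inner ℝ (C i X) Z - inner ℝ (φ X) (φ Z)))
          = ∑ i, (inner ℝ (C i X) Y * η i Z + η i Y * inner ℝ (C i X) Z)
          - ∑ i, (inner ℝ (φ X) (φ Y) * η i Z + η i Y * inner ℝ (φ X) (φ Z)) := by
        rw [← Finset.sum_sub_distrib]
        refine Finset.sum_congr rfl fun i _ ↦ ?_
        ring
      simp at h
      rw [e']
      linarith
    · intro j X Z
      simp only [D, b, inner_ξ, hηφ, hηξ, hAξ, inner_neg_left, φ_skew (C j X)]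
      rw [real_inner_comm (φ (φ Z)), φφ_inner]
      simp [hηφ, real_inner_comm (φ X)]
  refine ext_inner_right ℝ fun Z ↦ ?_
  have h := main Z
  simp only [D, sub_eq_zero] at h
  rw [h, sum_inner]
  refine Finset.sum_congr rfl fun i _ ↦ ?_
  simp [inner_sub_left, inner_smul_left, ξ_inner]

end Algebra

/-! ### Test functions and the Leibniz rule on a manifold. -/

section VectorFields

variable {F : Type*} [NormedAddCommGroup F] [NormedSpace ℝ F]
  {N : Type*} [TopologicalSpace N] [ChartedSpace F N] [IsManifold 𝓘(ℝ, F) ∞ N]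
  {X Y Z : (x : N) → TangentSpace 𝓘(ℝ, F) x} {x : N}

theorem SmoothAt.mdifferentiableAt (hX : SmoothAt X x) : MDiffAt (T% X) x :=
  ContMDiffAt.mdifferentiableAt hX (by simp)

theorem smoothAt_extend (v : TangentSpace 𝓘(ℝ, F) x) : SmoothAt (FiberBundle.extend F v) x :=
  FiberBundle.contMDiffAt_extend 𝓘(ℝ, F) F v

/-- A linear functional of the chart, normalized on the image of `u`. Multiplying a field by such a
function isolates the terms of `dΦ` that differentiate the field. -/
theorem exists_function_vanishing_at (u : TangentSpace 𝓘(ℝ, F) x) (hu : u ≠ 0) :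
    ∃ a : N → ℝ, ContMDiffAt 𝓘(ℝ, F) 𝓘(ℝ, ℝ) ∞ a x ∧ a x = 0 ∧ mvfderiv 𝓘(ℝ, F) a x u = 1 := by
  have hinv := isInvertible_mfderiv_extChartAt (I := 𝓘(ℝ, F)) (mem_extChartAt_source x)
  have h0 : (mfderiv 𝓘(ℝ, F) 𝓘(ℝ, F) (extChartAt 𝓘(ℝ, F) x) x u : F) ≠ (0 : F) := fun h ↦
    hu (hinv.injective (h.trans (map_zero _).symm))
  obtain ⟨l, hl⟩ : ∃ l : F →L[ℝ] ℝ,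
      l (mfderiv 𝓘(ℝ, F) 𝓘(ℝ, F) (extChartAt 𝓘(ℝ, F) x) x u) = 1 :=
    SeparatingDual.exists_eq_one h0
  have hc := contMDiffAt_extChartAt (I := 𝓘(ℝ, F)) (n := ∞) (x := x)
  have h1 : ContMDiffAt 𝓘(ℝ, F) 𝓘(ℝ, ℝ) ∞ (fun y ↦ l (extChartAt 𝓘(ℝ, F) x y)) x :=
    l.contMDiff.contMDiffAt.comp x hc
  refine ⟨fun y ↦ l (extChartAt 𝓘(ℝ, F) x y) - l (extChartAt 𝓘(ℝ, F) x x),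
    h1.sub contMDiffAt_const, by simp, ?_⟩
  have h2 : mfderiv 𝓘(ℝ, F) 𝓘(ℝ, ℝ) (fun y ↦ l (extChartAt 𝓘(ℝ, F) x y)) x =
      l.comp (mfderiv 𝓘(ℝ, F) 𝓘(ℝ, F) (extChartAt 𝓘(ℝ, F) x) x) :=
    ((l.hasMFDerivAt (x := extChartAt 𝓘(ℝ, F) x x)).comp x
      (hc.mdifferentiableAt (by simp)).hasMFDerivAt).mfderiv
  rw [mvfderiv_fun_sub (h1.mdifferentiableAt (by simp)) mdifferentiableAt_const, mvfderiv_const,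
    sub_zero, mvfderiv, h2]
  exact hl

/-- The Leibniz rule for a finite sum of multiples of vector fields. -/
theorem cov_sum_smul (cov : CovariantDerivative 𝓘(ℝ, F) F (fun x : N ↦ TangentSpace 𝓘(ℝ, F) x))
    {ι : Type*} {a : ι → N → ℝ} {Z : ι → (x : N) → TangentSpace 𝓘(ℝ, F) x}
    (ha : ∀ k, MDifferentiableAt 𝓘(ℝ, F) 𝓘(ℝ, ℝ) (a k) x) (hZ : ∀ k, MDiffAt (T% (Z k)) x)
    (t : Finset ι) :
    MDiffAt (T% (fun y ↦ ∑ k ∈ t, a k y • Z k y)) x ∧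
      ∀ u, cov (fun y ↦ ∑ k ∈ t, a k y • Z k y) x u =
        ∑ k ∈ t, (a k x • cov (Z k) x u + mvfderiv 𝓘(ℝ, F) (a k) x u • Z k x) := by
  classical
  have hd (t : Finset ι) : MDiffAt (T% (fun y ↦ ∑ k ∈ t, a k y • Z k y)) x :=
    .sum_section fun k _ ↦ (ha k).smul_section (hZ k)
  refine ⟨hd t, fun u ↦ ?_⟩
  induction t using Finset.induction_on with
  | empty =>
    have : (fun y ↦ ∑ k ∈ ∅, a k y • Z k y) = (0 : (y : N) → TangentSpace 𝓘(ℝ, F) y) := by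
      ext y
      simp
    rw [this, cov.zero]
    simp
  | insert k t hk ih =>
    have : (fun y ↦ ∑ k ∈ insert k t, a k y • Z k y) =
        a k • Z k + fun y ↦ ∑ k ∈ t, a k y • Z k y := by
      ext y
      simp [Finset.sum_insert hk]
    rw [this, cov.isCovariantDerivativeOnUniv.add ((ha k).smul_section (hZ k)) (hd t),
      cov.isCovariantDerivativeOnUniv.leibniz (hZ k) (ha k), Finset.sum_insert hk, ← ih]
    rfl

end VectorFields

/-! ### The covariant derivative of `φ` on the ambient manifold. -/

section Ambient

variable {F : Type*} [NormedAddCommGroup F] [NormedSpace ℝ F]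
  {N : Type*} [TopologicalSpace N] [ChartedSpace F N] [IsManifold 𝓘(ℝ, F) ∞ N]
  [RiemannianBundle (fun x : N ↦ TangentSpace 𝓘(ℝ, F) x)]
  {s : ℕ} {X Y Z : (x : N) → TangentSpace 𝓘(ℝ, F) x} {x : N}

namespace MetricFStructure

variable (S : MetricFStructure F N s)

theorem smoothAt_ξ (i : Fin s) (x : N) : SmoothAt (S.ξ i) x := S.contMDiff_ξ i x

theorem smoothAt_φ (hX : SmoothAt X x) : SmoothAt (fun y ↦ S.φ y (X y)) x :=
  ContMDiffAt.clm_bundle_apply (S.contMDiff_φ x) hX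

theorem mdifferentiableAt_φ (hX : MDiffAt (T% X) x) : MDiffAt (T% (fun y ↦ S.φ y (X y))) x :=
  MDifferentiableAt.clm_bundle_apply ((S.contMDiff_φ x).mdifferentiableAt (by simp)) hX

theorem mdifferentiableAt_η (i : Fin s) (hX : MDiffAt (T% X) x) :
    MDifferentiableAt 𝓘(ℝ, F) 𝓘(ℝ, ℝ) (fun y ↦ S.η i y (X y)) x := by
  have := MDifferentiableAt.clm_bundle_apply
    ((S.contMDiff_η i x).mdifferentiableAt (by simp)) hX
  simp only [mdifferentiableAt_totalSpace] at this
  exact this.2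

variable [IsContMDiffRiemannianBundle 𝓘(ℝ, F) ∞ F (fun x : N ↦ TangentSpace 𝓘(ℝ, F) x)]

omit S in
theorem _root_.GenKenmotsu.mdifferentiableAt_inner (hX : MDiffAt (T% X) x)
    (hY : MDiffAt (T% Y) x) :
    MDifferentiableAt 𝓘(ℝ, F) 𝓘(ℝ, ℝ) (fun y ↦ inner ℝ (X y) (Y y)) x :=
  MDifferentiableAt.inner_bundle (IB := 𝓘(ℝ, F)) (F := F)
    (E := (fun x : N ↦ TangentSpace 𝓘(ℝ, F) x)) hX hY

variable {S} {n : ℕ} [FiniteDimensional ℝ F]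

/-- The equation `dΦ = 2 ∑ η^i ∧ Φ`, for all vector fields, forces `Φ` to be skew-symmetric. -/
theorem IsGeneralizedAlmostKenmotsu.Φ_skew (hS : S.IsGeneralizedAlmostKenmotsu n)
    (u v : TangentSpace 𝓘(ℝ, F) x) : S.Φ x u v = -S.Φ x v u := by
  have i : Fin s := ⟨0, hS.one_le⟩
  have hξ : S.ξ i x ≠ 0 := fun h ↦ by simpa [h] using S.η_ξ x i i
  obtain ⟨a, ha, ha0, ha1⟩ := exists_function_vanishing_at (S.ξ i x) hξ
  let X : (x : N) → TangentSpace 𝓘(ℝ, F) x := FiberBundle.extend F u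
  let Z : (x : N) → TangentSpace 𝓘(ℝ, F) x := FiberBundle.extend F v
  let Y := S.ξ i
  have hX : SmoothAt X x := smoothAt_extend u
  have hZ : SmoothAt Z x := smoothAt_extend v
  have hY : SmoothAt Y x := S.smoothAt_ξ i x
  have Xx : X x = u := by simp [X]
  have Zx : Z x = v := by simp [Z]
  have had : MDifferentiableAt 𝓘(ℝ, F) 𝓘(ℝ, ℝ) a x := ha.mdifferentiableAt (by simp)
  have haX : SmoothAt (a • X) x := ha.smul_section hX
  -- The field `a • X` vanishes at `x`, so the wedge side is zero. On the other side the derivative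
  -- along `ξ_i` gives `Φ(v, u)`, the bracket with `ξ_i` gives `Φ(u, v)`, and the two terms
  -- containing `da(v)` cancel.
  have h := hS.dΦ_eq x (a • X) Y Z haX hY hZ
  have hΦ {V W : (x : N) → TangentSpace 𝓘(ℝ, F) x} (hV : SmoothAt V x) (hW : SmoothAt W x) :
      MDifferentiableAt 𝓘(ℝ, F) 𝓘(ℝ, ℝ) (fun y ↦ S.Φ y (V y) (W y)) x :=
    mdifferentiableAt_inner hV.mdifferentiableAt (S.smoothAt_φ hW).mdifferentiableAt
  have e1 : (fun y ↦ S.Φ y (Z y) ((a • X) y)) = fun y ↦ a y * S.Φ y (Z y) (X y) := by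
    ext y
    simp [Φ, inner_smul_right]
  have e2 : (fun y ↦ S.Φ y ((a • X) y) (Y y)) = fun y ↦ a y * S.Φ y (X y) (Y y) := by
    ext y
    simp [Φ, inner_smul_left]
  have e3 : (a • X) x = 0 := by simp [ha0]
  have d1 : dirDeriv Y (fun y ↦ S.Φ y (Z y) ((a • X) y)) x = S.Φ x v u := by
    rw [e1, dirDeriv, mvfderiv_fun_mul had (hΦ hZ hX)]
    simp [ha0, ha1, Y, Xx, Zx]
  have d2 : dirDeriv Z (fun y ↦ S.Φ y ((a • X) y) (Y y)) x =
      mvfderiv 𝓘(ℝ, F) a x v * S.Φ x u (Y x) := by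
    rw [e2, dirDeriv, mvfderiv_fun_mul had (hΦ hX hY)]
    simp [ha0, Xx, Zx, mul_comm]
  have b1 : mlieBracket 𝓘(ℝ, F) (a • X) Y x = -u := by
    rw [mlieBracket_smul_left had hX.mdifferentiableAt]
    simp [ha0, ha1, Y, Xx]
  have b2 : mlieBracket 𝓘(ℝ, F) Z (a • X) x = mvfderiv 𝓘(ℝ, F) a x v • u := by
    rw [mlieBracket_smul_right had hX.mdifferentiableAt]
    simp [ha0, Xx, Zx]
  rw [extDerivTwoForm, d1, d2, b1, b2, e3, Zx] at h
  simp [dirDeriv, wedgeOneTwo, Φ, e3, inner_neg_left, inner_smul_left] at h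
  simp only [Φ]
  linarith

namespace IsGeneralizedAlmostKenmotsu

variable (hS : S.IsGeneralizedAlmostKenmotsu n)
include hS

theorem inner_φ_left (u v : TangentSpace 𝓘(ℝ, F) x) :
    inner ℝ (S.φ x u) v = -inner ℝ u (S.φ x v) := by
  have h := hS.Φ_skew u v
  simp only [Φ] at h
  rw [h, neg_neg, real_inner_comm]

/-- By skewness `|φ ξ_i|² = -g(ξ_i, φ² ξ_i)`, and `φ² ξ_i = 0`. -/
theorem φ_ξ (i : Fin s) : S.φ x (S.ξ i x) = 0 := by
  have h : S.φ x (S.φ x (S.ξ i x)) = 0 := by simp [S.φ_φ, S.η_ξ]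
  have h1 := hS.inner_φ_left (S.ξ i x) (S.φ x (S.ξ i x))
  rw [h, inner_zero_right, neg_zero] at h1
  exact inner_self_eq_zero.1 h1

theorem inner_ξ (i : Fin s) (v : TangentSpace 𝓘(ℝ, F) x) : inner ℝ v (S.ξ i x) = S.η i x v := by
  have h := S.inner_φ_φ x v (S.ξ i x)
  rw [hS.φ_ξ, inner_zero_right] at h
  simp [S.η_ξ] at h
  linarith

theorem η_φ (i : Fin s) (v : TangentSpace 𝓘(ℝ, F) x) : S.η i x (S.φ x v) = 0 := by
  rw [← hS.inner_ξ, hS.inner_φ_left, hS.φ_ξ, inner_zero_right, neg_zero]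

end IsGeneralizedAlmostKenmotsu

end MetricFStructure

variable [IsContMDiffRiemannianBundle 𝓘(ℝ, F) ∞ F (fun x : N ↦ TangentSpace 𝓘(ℝ, F) x)]
  [FiniteDimensional ℝ F]
  {cov : CovariantDerivative 𝓘(ℝ, F) F (fun x : N ↦ TangentSpace 𝓘(ℝ, F) x)}

theorem IsLeviCivita.sub_eq_mlieBracket (h : IsLeviCivita cov) (hX : MDiffAt (T% X) x)
    (hY : MDiffAt (T% Y) x) :
    cov Y x (X x) - cov X x (Y x) = mlieBracket 𝓘(ℝ, F) X Y x :=
  cov.torsion_eq_zero_iff.1 h.torsion_eq_zero hX hY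

theorem IsLeviCivita.dirDeriv_inner (h : IsLeviCivita cov) (hY : MDiffAt (T% Y) x)
    (hZ : MDiffAt (T% Z) x) :
    dirDeriv X (fun y ↦ inner ℝ (Y y) (Z y)) x =
      inner ℝ (cov Y x (X x)) (Z x) + inner ℝ (Y x) (cov Z x (X x)) :=
  h.metric.mvfderiv_inner_eq X hY hZ

namespace MetricFStructure

variable (S : MetricFStructure F N s)
-- The terms that differentiate the coefficient `a` cancel because `φ` is linear over functions.
-- This makes `∇φ` a tensor, so the structure equations become pointwise algebra.
variable (cov) in
omit [IsContMDiffRiemannianBundle 𝓘(ℝ, F) ∞ F (fun x : N ↦ TangentSpace 𝓘(ℝ, F) x)]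
  [FiniteDimensional ℝ F] in
theorem tensorialAt_covDeriv_φ (x : N) :
    TensorialAt 𝓘(ℝ, F) F (fun Y : (x : N) → TangentSpace 𝓘(ℝ, F) x ↦
      cov (fun y ↦ S.φ y (Y y)) x - (S.φ x).comp (cov Y x)) x where
  smul {a Y} ha hY := by
    have : (fun y ↦ S.φ y ((a • Y) y)) = a • fun y ↦ S.φ y (Y y) := by
      ext y
      simp
    rw [this, cov.isCovariantDerivativeOnUniv.leibniz (S.mdifferentiableAt_φ hY) ha,
      cov.isCovariantDerivativeOnUniv.leibniz hY ha]
    ext u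
    simp [smul_sub]
  add {Y Z} hY hZ := by
    have : (fun y ↦ S.φ y ((Y + Z) y)) = (fun y ↦ S.φ y (Y y)) + fun y ↦ S.φ y (Z y) := by
      ext y
      simp
    rw [this, cov.isCovariantDerivativeOnUniv.add (S.mdifferentiableAt_φ hY)
      (S.mdifferentiableAt_φ hZ), cov.isCovariantDerivativeOnUniv.add hY hZ]
    ext u
    simp
    abel

variable (cov) in
/-- The tensor `∇ φ`, with `S.nablaφ cov x v u = (∇_u φ) v`. -/
def nablaφ (x : N) :
    TangentSpace 𝓘(ℝ, F) x →L[ℝ] TangentSpace 𝓘(ℝ, F) x →L[ℝ] TangentSpace 𝓘(ℝ, F) x :=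
  TensorialAt.mkHom _ x (S.tensorialAt_covDeriv_φ cov x)

omit [IsContMDiffRiemannianBundle 𝓘(ℝ, F) ∞ F (fun x : N ↦ TangentSpace 𝓘(ℝ, F) x)] in
theorem nablaφ_apply (hY : MDiffAt (T% Y) x) (u : TangentSpace 𝓘(ℝ, F) x) :
    S.nablaφ cov x (Y x) u = cov (fun y ↦ S.φ y (Y y)) x u - S.φ x (cov Y x u) := by
  rw [nablaφ, TensorialAt.mkHom_apply _ hY]
  rfl

omit [IsContMDiffRiemannianBundle 𝓘(ℝ, F) ∞ F (fun x : N ↦ TangentSpace 𝓘(ℝ, F) x)] in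
theorem cov_φ (hY : MDiffAt (T% Y) x) (u : TangentSpace 𝓘(ℝ, F) x) :
    cov (fun y ↦ S.φ y (Y y)) x u = S.nablaφ cov x (Y x) u + S.φ x (cov Y x u) := by
  rw [S.nablaφ_apply hY, sub_add_cancel]

variable {S} {n : ℕ}

namespace IsGeneralizedAlmostKenmotsu

variable (hS : S.IsGeneralizedAlmostKenmotsu n) (hcov : IsLeviCivita cov)
include hS hcov

/-- The derivative of `g(φY, Z) = -g(Y, φZ)`. -/
theorem inner_nablaφ (u v w : TangentSpace 𝓘(ℝ, F) x) :
    inner ℝ (S.nablaφ cov x v u) w = -inner ℝ v (S.nablaφ cov x w u) := by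
  obtain ⟨X, Xx⟩ : ∃ X : (x : N) → TangentSpace 𝓘(ℝ, F) x, X x = u :=
    ⟨FiberBundle.extend F u, by simp⟩
  obtain ⟨Y, hY, rfl⟩ : ∃ Y : (x : N) → TangentSpace 𝓘(ℝ, F) x, MDiffAt (T% Y) x ∧ Y x = v :=
    ⟨_, FiberBundle.mdifferentiableAt_extend 𝓘(ℝ, F) F v, by simp⟩
  obtain ⟨Z, hZ, rfl⟩ : ∃ Z : (x : N) → TangentSpace 𝓘(ℝ, F) x, MDiffAt (T% Z) x ∧ Z x = w :=
    ⟨_, FiberBundle.mdifferentiableAt_extend 𝓘(ℝ, F) F w, by simp⟩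
  have h1 := hcov.dirDeriv_inner (X := X) (S.mdifferentiableAt_φ hY) hZ
  have h2 := hcov.dirDeriv_inner (X := X) hY (S.mdifferentiableAt_φ hZ)
  have h3 : (fun y ↦ inner ℝ (S.φ y (Y y)) (Z y)) = -fun y ↦ inner ℝ (Y y) (S.φ y (Z y)) := by
    ext y
    exact hS.inner_φ_left _ _
  rw [h3, dirDeriv, mvfderiv_neg, _root_.neg_apply, ← dirDeriv, h2] at h1
  rw [S.nablaφ_apply hY, S.nablaφ_apply hZ, inner_sub_left, inner_sub_right, hS.inner_φ_left,
    ← Xx]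
  rw [hS.inner_φ_left] at h1
  linarith

/-- Since `η^i = g(·, ξ_i)` and the torsion vanishes, `dη^i` is half the antisymmetrization of
`g(∇_X ξ_i, Y)`. -/
theorem inner_cov_ξ_symm (i : Fin s) (u v : TangentSpace 𝓘(ℝ, F) x) :
    inner ℝ (cov (S.ξ i) x u) v = inner ℝ (cov (S.ξ i) x v) u := by
  obtain ⟨X, hX, rfl⟩ : ∃ X : (x : N) → TangentSpace 𝓘(ℝ, F) x, SmoothAt X x ∧ X x = u :=
    ⟨_, smoothAt_extend u, by simp⟩
  obtain ⟨Y, hY, rfl⟩ : ∃ Y : (x : N) → TangentSpace 𝓘(ℝ, F) x, SmoothAt Y x ∧ Y x = v :=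
    ⟨_, smoothAt_extend v, by simp⟩
  have h := hS.dη_eq_zero i x X Y hX hY
  simp only [extDerivOneForm, ← hS.inner_ξ] at h
  have hξ := (S.smoothAt_ξ i x).mdifferentiableAt
  rw [hcov.dirDeriv_inner hX.mdifferentiableAt hξ, hcov.dirDeriv_inner hY.mdifferentiableAt hξ,
    ← hcov.sub_eq_mlieBracket hX.mdifferentiableAt hY.mdifferentiableAt, inner_sub_left] at h
  rw [real_inner_comm, real_inner_comm (X x)]
  linarith

omit hcov in
theorem nablaφ_ξ (i : Fin s) (u : TangentSpace 𝓘(ℝ, F) x) :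
    S.nablaφ cov x (S.ξ i x) u = -S.φ x (cov (S.ξ i) x u) := by
  have h : (fun y ↦ S.φ y (S.ξ i y)) = (0 : (y : N) → TangentSpace 𝓘(ℝ, F) y) := by
    ext y
    exact hS.φ_ξ i
  rw [S.nablaφ_apply (S.smoothAt_ξ i x).mdifferentiableAt, h, cov.zero]
  simp

/-- The derivative of `φ² Y = -Y + ∑ η^i(Y) ξ_i`, after cancelling the terms in `∇Y`. -/
theorem nablaφ_φ_add (u v : TangentSpace 𝓘(ℝ, F) x) :
    S.nablaφ cov x (S.φ x v) u + S.φ x (S.nablaφ cov x v u) =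
      ∑ i, (inner ℝ (cov (S.ξ i) x u) v • S.ξ i x + S.η i x v • cov (S.ξ i) x u) := by
  obtain ⟨X, Xx⟩ : ∃ X : (x : N) → TangentSpace 𝓘(ℝ, F) x, X x = u :=
    ⟨FiberBundle.extend F u, by simp⟩
  obtain ⟨Y, hY, rfl⟩ : ∃ Y : (x : N) → TangentSpace 𝓘(ℝ, F) x, MDiffAt (T% Y) x ∧ Y x = v :=
    ⟨_, FiberBundle.mdifferentiableAt_extend 𝓘(ℝ, F) F v, by simp⟩
  have hξ (i) := (S.smoothAt_ξ i x).mdifferentiableAt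
  have h1 := S.cov_φ (cov := cov) (S.mdifferentiableAt_φ hY) u
  rw [S.cov_φ hY, map_add, S.φ_φ] at h1
  obtain ⟨h2, h3⟩ := cov_sum_smul cov (fun i ↦ S.mdifferentiableAt_η i hY) hξ Finset.univ
  have h4 : (fun y ↦ S.φ y (S.φ y (Y y))) =
      (fun _ : N ↦ (-1 : ℝ)) • Y + fun y ↦ ∑ i, S.η i y (Y y) • S.ξ i y := by
    ext y
    simp [S.φ_φ]
  have h5 : MDiffAt (T% ((fun _ : N ↦ (-1 : ℝ)) • Y)) x := mdifferentiableAt_const.smul_section hY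
  rw [h4, cov.isCovariantDerivativeOnUniv.add h5 h2,
    cov.isCovariantDerivativeOnUniv.leibniz hY mdifferentiableAt_const, add_apply, h3,
    mvfderiv_const] at h1
  have h6 (i) : mvfderiv 𝓘(ℝ, F) (fun y ↦ S.η i y (Y y)) x u =
      S.η i x (cov Y x u) + inner ℝ (cov (S.ξ i) x u) (Y x) := by
    have := hcov.dirDeriv_inner (X := X) hY (hξ i)
    simp only [hS.inner_ξ, dirDeriv, Xx] at this
    rw [this, real_inner_comm (Y x)]
  simp only [h6, add_smul, Finset.sum_add_distrib] at h1 ⊢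
  simp at h1
  have h7 := congrArg (· + cov Y x u - ∑ i, S.η i x (cov Y x u) • S.ξ i x) h1
  rw [eq_comm]
  convert h7 using 1 <;> abel

/-- For a torsion-free metric connection `dΦ` is the cyclic sum of `∇Φ`, up to the factor `1/3`,
which also stands in the wedge product. Both sides change sign in passing from `g(Y, φZ)` to `g(φY,
Z)`. -/
theorem cyclic_inner_nablaφ (u v w : TangentSpace 𝓘(ℝ, F) x) :
    inner ℝ (S.nablaφ cov x v u) w + inner ℝ (S.nablaφ cov x w v) u +
        inner ℝ (S.nablaφ cov x u w) v =
      2 * ∑ i, (S.η i x u * inner ℝ (S.φ x v) w + S.η i x v * inner ℝ (S.φ x w) u +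
        S.η i x w * inner ℝ (S.φ x u) v) := by
  obtain ⟨X, hX, rfl⟩ : ∃ X : (x : N) → TangentSpace 𝓘(ℝ, F) x, SmoothAt X x ∧ X x = u :=
    ⟨_, smoothAt_extend u, by simp⟩
  obtain ⟨Y, hY, rfl⟩ : ∃ Y : (x : N) → TangentSpace 𝓘(ℝ, F) x, SmoothAt Y x ∧ Y x = v :=
    ⟨_, smoothAt_extend v, by simp⟩
  obtain ⟨Z, hZ, rfl⟩ : ∃ Z : (x : N) → TangentSpace 𝓘(ℝ, F) x, SmoothAt Z x ∧ Z x = w :=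
    ⟨_, smoothAt_extend w, by simp⟩
  have h := hS.dΦ_eq x X Y Z hX hY hZ
  have hX' := hX.mdifferentiableAt
  have hY' := hY.mdifferentiableAt
  have hZ' := hZ.mdifferentiableAt
  simp only [extDerivTwoForm, wedgeOneTwo, Φ] at h
  rw [hcov.dirDeriv_inner hY' (S.mdifferentiableAt_φ hZ'),
    hcov.dirDeriv_inner hZ' (S.mdifferentiableAt_φ hX'),
    hcov.dirDeriv_inner hX' (S.mdifferentiableAt_φ hY'), S.cov_φ hX', S.cov_φ hY', S.cov_φ hZ',
    ← hcov.sub_eq_mlieBracket hX' hY', ← hcov.sub_eq_mlieBracket hY' hZ',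
    ← hcov.sub_eq_mlieBracket hZ' hX'] at h
  simp only [inner_add_right, inner_sub_left] at h
  have c1 (a b : TangentSpace 𝓘(ℝ, F) x) : inner ℝ a (S.φ x b) = -inner ℝ b (S.φ x a) := by
    rw [real_inner_comm, hS.inner_φ_left]
  have e1 := hS.inner_nablaφ hcov (X x) (Y x) (Z x)
  have e2 := hS.inner_nablaφ hcov (Y x) (Z x) (X x)
  have e3 := hS.inner_nablaφ hcov (Z x) (X x) (Y x)
  have e4 := c1 (Y x) (cov Z x (X x))
  have e5 := c1 (Z x) (cov X x (Y x))
  have e6 := c1 (X x) (cov Y x (Z x))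
  simp only [hS.inner_φ_left, ← Finset.mul_sum] at h ⊢
  simp only [mul_neg, Finset.sum_add_distrib, Finset.sum_neg_distrib] at h ⊢
  linarith

end IsGeneralizedAlmostKenmotsu

namespace IsGeneralizedKenmotsu

variable (hS : S.IsGeneralizedKenmotsu n) (hcov : IsLeviCivita cov)
include hS hcov

/-- As `dη^i = 0`, normality means `[φ, φ] = 0`; writing the brackets through `∇`, all derivatives
of `X` and `Y` cancel. -/
theorem nijenhuis_nablaφ (u v : TangentSpace 𝓘(ℝ, F) x) :
    S.nablaφ cov x v (S.φ x u) - S.nablaφ cov x u (S.φ x v) - S.φ x (S.nablaφ cov x v u) +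
      S.φ x (S.nablaφ cov x u v) = 0 := by
  obtain ⟨X, hX, rfl⟩ : ∃ X : (x : N) → TangentSpace 𝓘(ℝ, F) x, SmoothAt X x ∧ X x = u :=
    ⟨_, smoothAt_extend u, by simp⟩
  obtain ⟨Y, hY, rfl⟩ : ∃ Y : (x : N) → TangentSpace 𝓘(ℝ, F) x, SmoothAt Y x ∧ Y x = v :=
    ⟨_, smoothAt_extend v, by simp⟩
  have h := hS.normal x X Y hX hY
  simp only [hS.almost.dη_eq_zero _ x X Y hX hY, zero_smul, Finset.sum_const_zero, smul_zero,
    add_zero, nijenhuis] at h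
  have hX' := hX.mdifferentiableAt
  have hY' := hY.mdifferentiableAt
  have hφX := S.mdifferentiableAt_φ hX'
  have hφY := S.mdifferentiableAt_φ hY'
  rw [← hcov.sub_eq_mlieBracket hX' hY', ← hcov.sub_eq_mlieBracket hφX hφY,
    ← hcov.sub_eq_mlieBracket hφX hY', ← hcov.sub_eq_mlieBracket hX' hφY, S.cov_φ hX',
    S.cov_φ hY', S.cov_φ hX', S.cov_φ hY'] at h
  simp only [map_sub, map_add] at h
  rw [← h]
  abel

/-- On a generalized Kenmotsu manifold,
`(∇_X φ) Y = ∑ (g(φ X, Y) ξ_i - η^i(Y) φ X)`. -/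
theorem nablaφ_eq (u v : TangentSpace 𝓘(ℝ, F) x) :
    S.nablaφ cov x v u =
      ∑ i, (inner ℝ (S.φ x u) v • S.ξ i x - S.η i x v • S.φ x u) :=
  structureEquations_solution (V := TangentSpace 𝓘(ℝ, F) x) (S.φ_φ x) (S.η_ξ x)
    (fun _ ↦ hS.almost.φ_ξ _) hS.almost.η_φ hS.almost.inner_ξ hS.almost.inner_φ_left
    (hS.almost.inner_cov_ξ_symm hcov) (hS.almost.inner_nablaφ hcov)
    (hS.almost.cyclic_inner_nablaφ hcov) (hS.nijenhuis_nablaφ hcov)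
    (hS.almost.nablaφ_φ_add hcov) hS.almost.nablaφ_ξ u v

end IsGeneralizedKenmotsu

end MetricFStructure

end Ambient

/-! ### The induced connection on vector fields along a map. -/

section Along

variable {E : Type*} [NormedAddCommGroup E] [NormedSpace ℝ E]
  {M : Type*} [TopologicalSpace M] [ChartedSpace E M]
  {F : Type*} [NormedAddCommGroup F] [NormedSpace ℝ F]
  {N : Type*} [TopologicalSpace N] [ChartedSpace F N] [IsManifold 𝓘(ℝ, F) ∞ N]
  {f : M → N} {p : M} {V W : (q : M) → TangentSpace 𝓘(ℝ, F) (f q)}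

/-- The vector field `V` along `f` is differentiable at `p`. -/
def MDiffAlongAt (f : M → N) (V : (q : M) → TangentSpace 𝓘(ℝ, F) (f q)) (p : M) : Prop :=
  MDifferentiableAt 𝓘(ℝ, E) (𝓘(ℝ, F).prod 𝓘(ℝ, F))
    (fun q ↦ TotalSpace.mk' F (E := fun x : N ↦ TangentSpace 𝓘(ℝ, F) x) (f q) (V q)) p

/-- The coordinates of `V` in the preferred trivialization at `f p`. -/
def alongCoord (f : M → N) (V : (q : M) → TangentSpace 𝓘(ℝ, F) (f q)) (p q : M) : F :=
  (trivializationAt F (fun x : N ↦ TangentSpace 𝓘(ℝ, F) x) (f p)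
    (TotalSpace.mk' F (f q) (V q))).2

theorem mdiffAlongAt_iff : MDiffAlongAt (E := E) f V p ↔ MDifferentiableAt 𝓘(ℝ, E) 𝓘(ℝ, F) f p ∧
    MDifferentiableAt 𝓘(ℝ, E) 𝓘(ℝ, F) (alongCoord f V p) p := by
  simp only [MDiffAlongAt, mdifferentiableAt_totalSpace]
  rfl

theorem mem_baseSet (x : N) :
    x ∈ (trivializationAt F (fun x : N ↦ TangentSpace 𝓘(ℝ, F) x) x).baseSet :=
  FiberBundle.mem_baseSet_trivializationAt' x

theorem eventually_mem_baseSet_self (x : N) : ∀ᶠ y in 𝓝 x,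
    y ∈ (trivializationAt F (fun x : N ↦ TangentSpace 𝓘(ℝ, F) x) x).baseSet :=
  (trivializationAt F (fun x : N ↦ TangentSpace 𝓘(ℝ, F) x) x).open_baseSet.mem_nhds (mem_baseSet x)

theorem eventually_mem_baseSet (hf : MDifferentiableAt 𝓘(ℝ, E) 𝓘(ℝ, F) f p) : ∀ᶠ q in 𝓝 p,
    f q ∈ (trivializationAt F (fun x : N ↦ TangentSpace 𝓘(ℝ, F) x) (f p)).baseSet :=
  hf.continuousAt (eventually_mem_baseSet_self (f p))

omit [TopologicalSpace M] in
theorem alongCoord_eq {q : M}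
    (hq : f q ∈ (trivializationAt F (fun x : N ↦ TangentSpace 𝓘(ℝ, F) x) (f p)).baseSet) :
    alongCoord f V p q = (trivializationAt F (fun x : N ↦ TangentSpace 𝓘(ℝ, F) x)
      (f p)).continuousLinearMapAt ℝ (f q) (V q) := by
  rw [Trivialization.continuousLinearMapAt_apply, Trivialization.coe_linearMapAt_of_mem _ hq]
  rfl

theorem alongCoord_add (hf : MDifferentiableAt 𝓘(ℝ, E) 𝓘(ℝ, F) f p) :
    alongCoord f (fun q ↦ V q + W q) p =ᶠ[𝓝 p] alongCoord f V p + alongCoord f W p := by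
  filter_upwards [eventually_mem_baseSet hf] with q hq
  simp only [Pi.add_apply, alongCoord_eq hq, map_add]

theorem alongCoord_smul (hf : MDifferentiableAt 𝓘(ℝ, E) 𝓘(ℝ, F) f p) (a : M → ℝ) :
    alongCoord f (fun q ↦ a q • V q) p =ᶠ[𝓝 p] a • alongCoord f V p := by
  filter_upwards [eventually_mem_baseSet hf] with q hq
  simp only [Pi.smul_apply', alongCoord_eq hq, map_smul]

theorem MDiffAlongAt.add (hV : MDiffAlongAt (E := E) f V p) (hW : MDiffAlongAt (E := E) f W p) :
    MDiffAlongAt (E := E) f (fun q ↦ V q + W q) p := by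
  rw [mdiffAlongAt_iff] at *
  exact ⟨hV.1, (hV.2.add hW.2).congr_of_eventuallyEq (alongCoord_add hV.1)⟩

theorem MDiffAlongAt.smul {a : M → ℝ} (ha : MDifferentiableAt 𝓘(ℝ, E) 𝓘(ℝ, ℝ) a p)
    (hV : MDiffAlongAt (E := E) f V p) :
    MDiffAlongAt (E := E) f (fun q ↦ a q • V q) p := by
  rw [mdiffAlongAt_iff] at *
  exact ⟨hV.1, (ha.smul hV.2).congr_of_eventuallyEq (alongCoord_smul hV.1 a)⟩

theorem MDiffAlongAt.of_comp (hf : MDifferentiableAt 𝓘(ℝ, E) 𝓘(ℝ, F) f p)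
    {Z : (x : N) → TangentSpace 𝓘(ℝ, F) x} (hZ : MDiffAt (T% Z) (f p)) :
    MDiffAlongAt (E := E) f (fun q ↦ Z (f q)) p :=
  MDifferentiableAt.comp p hZ hf

theorem alongCoord_congr (h : ∀ᶠ q in 𝓝 p, V q = W q) :
    alongCoord f V p =ᶠ[𝓝 p] alongCoord f W p := by
  filter_upwards [h] with q hq
  simp [alongCoord, hq]

/-- The vector field on `N` with constant coordinates `v` in the trivialization at `x`. -/
def coordField (x : N) (v : F) (y : N) : TangentSpace 𝓘(ℝ, F) y :=
  (trivializationAt F (fun x : N ↦ TangentSpace 𝓘(ℝ, F) x) x).symm y v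

theorem mdifferentiableAt_coordField (x : N) (v : F) : MDiffAt (T% (coordField x v)) x := by
  have := FiberBundle.mdifferentiableAt_extend 𝓘(ℝ, F) F
    (V := fun x : N ↦ TangentSpace 𝓘(ℝ, F) x) (coordField x v x)
  simp only [FiberBundle.extend, coordField,
    Trivialization.apply_mk_symm _ (mem_baseSet x) v] at this
  exact this

omit [TopologicalSpace M] in
theorem coordField_alongCoord {q : M}
    (hq : f q ∈ (trivializationAt F (fun x : N ↦ TangentSpace 𝓘(ℝ, F) x) (f p)).baseSet) :
    coordField (f p) (alongCoord f V p q) (f q) = V q :=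
  Trivialization.symm_apply_apply_mk _ hq _

theorem coordField_add {x y : N}
    (hy : y ∈ (trivializationAt F (fun x : N ↦ TangentSpace 𝓘(ℝ, F) x) x).baseSet) (v w : F) :
    coordField x (v + w) y = coordField x v y + coordField x w y := by
  simp only [coordField, ← Trivialization.symmₗ_apply (R := ℝ) _ hy, map_add]

theorem coordField_smul {x y : N}
    (hy : y ∈ (trivializationAt F (fun x : N ↦ TangentSpace 𝓘(ℝ, F) x) x).baseSet)
    (a : ℝ) (v : F) :
    coordField x (a • v) y = a • coordField x v y := by
  simp only [coordField, ← Trivialization.symmₗ_apply (R := ℝ) _ hy, map_smul]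

variable {cov : CovariantDerivative 𝓘(ℝ, F) F (fun x : N ↦ TangentSpace 𝓘(ℝ, F) x)}

theorem covDerivAlong_eq (u : TangentSpace 𝓘(ℝ, E) p) :
    covDerivAlong cov f V p u = coordField (f p) (mvfderiv 𝓘(ℝ, E) (alongCoord f V p) p u) (f p) +
      cov (coordField (f p) (alongCoord f V p p)) (f p) (mfderiv 𝓘(ℝ, E) 𝓘(ℝ, F) f p u) := rfl

theorem mvfderiv_congr {G : Type*} [NormedAddCommGroup G] [NormedSpace ℝ G] {c d : M → G}
    (h : c =ᶠ[𝓝 p] d) :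
    mvfderiv 𝓘(ℝ, E) c p = mvfderiv 𝓘(ℝ, E) d p := by
  ext u
  simp only [mvfderiv, ContinuousLinearMap.comp_apply, h.mfderiv_eq]
  rfl

theorem covDerivAlong_congr (h : ∀ᶠ q in 𝓝 p, V q = W q) (u : TangentSpace 𝓘(ℝ, E) p) :
    covDerivAlong cov f V p u = covDerivAlong cov f W p u := by
  have h1 := alongCoord_congr h
  rw [covDerivAlong_eq, covDerivAlong_eq, mvfderiv_congr h1, h1.self_of_nhds]

theorem cov_coordField_add (x : N) (v w : F) (u : TangentSpace 𝓘(ℝ, F) x) :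
    cov (coordField x (v + w)) x u =
      cov (coordField x v) x u + cov (coordField x w) x u := by
  have h : ∀ᶠ y in 𝓝 x, coordField x (v + w) y = (coordField x v + coordField x w) y := by
    filter_upwards [eventually_mem_baseSet_self (F := F) x] with y hy
    exact coordField_add hy v w
  have hv := mdifferentiableAt_coordField x v
  have hw := mdifferentiableAt_coordField x w
  rw [cov.isCovariantDerivativeOnUniv.congr_of_eventuallyEq (mdifferentiableAt_coordField x _)
    (mdifferentiableAt_add_section hv hw) Filter.univ_mem h,
    cov.isCovariantDerivativeOnUniv.add hv hw]
  rfl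

theorem cov_coordField_smul (x : N) (a : ℝ) (v : F) (u : TangentSpace 𝓘(ℝ, F) x) :
    cov (coordField x (a • v)) x u = a • cov (coordField x v) x u := by
  have h : ∀ᶠ y in 𝓝 x, coordField x (a • v) y = ((fun _ : N ↦ a) • coordField x v) y := by
    filter_upwards [eventually_mem_baseSet_self (F := F) x] with y hy
    exact coordField_smul hy a v
  have hv := mdifferentiableAt_coordField x v
  rw [cov.isCovariantDerivativeOnUniv.congr_of_eventuallyEq (mdifferentiableAt_coordField x _)
    (mdifferentiableAt_const.smul_section hv) Filter.univ_mem h,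
    cov.isCovariantDerivativeOnUniv.leibniz hv mdifferentiableAt_const, mvfderiv_const]
  simp

theorem covDerivAlong_add (hV : MDiffAlongAt (E := E) f V p) (hW : MDiffAlongAt (E := E) f W p)
    (u : TangentSpace 𝓘(ℝ, E) p) :
    covDerivAlong cov f (fun q ↦ V q + W q) p u =
      covDerivAlong cov f V p u + covDerivAlong cov f W p u := by
  rw [mdiffAlongAt_iff] at hV hW
  have h := alongCoord_add (V := V) (W := W) hV.1
  rw [covDerivAlong_eq, covDerivAlong_eq, covDerivAlong_eq, mvfderiv_congr h, h.self_of_nhds,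
    mvfderiv_add hV.2 hW.2, Pi.add_apply, add_apply, cov_coordField_add,
    coordField_add (mem_baseSet (f p))]
  abel

theorem covDerivAlong_smul {a : M → ℝ} (ha : MDifferentiableAt 𝓘(ℝ, E) 𝓘(ℝ, ℝ) a p)
    (hV : MDiffAlongAt (E := E) f V p) (u : TangentSpace 𝓘(ℝ, E) p) :
    covDerivAlong cov f (fun q ↦ a q • V q) p u =
      a p • covDerivAlong cov f V p u + mvfderiv 𝓘(ℝ, E) a p u • V p := by
  rw [mdiffAlongAt_iff] at hV
  have h := alongCoord_smul (V := V) hV.1 a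
  rw [covDerivAlong_eq, covDerivAlong_eq, mvfderiv_congr h, h.self_of_nhds, Pi.smul_apply',
    cov_coordField_smul, mvfderiv_smul ha hV.2]
  simp only [add_apply, smul_apply, ContinuousLinearMap.smulRight_apply]
  rw [coordField_add (mem_baseSet (f p)), coordField_smul (mem_baseSet (f p)),
    coordField_smul (mem_baseSet (f p)), coordField_alongCoord (mem_baseSet (f p)), smul_add]
  abel

theorem MDiffAlongAt.mdifferentiableAt (hV : MDiffAlongAt (E := E) f V p) :
    MDifferentiableAt 𝓘(ℝ, E) 𝓘(ℝ, F) f p :=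
  (mdiffAlongAt_iff.1 hV).1

variable [FiniteDimensional ℝ F]

/-- To prove a property of differentiable vector fields along `f` it suffices to prove it for
restrictions of vector fields, and its stability under linear combinations. -/
theorem MDiffAlongAt.induction {P : ((q : M) → TangentSpace 𝓘(ℝ, F) (f q)) → Prop}
    (hcongr : ∀ V W, (∀ᶠ q in 𝓝 p, V q = W q) → P V → P W)
    (hadd : ∀ V W, MDiffAlongAt (E := E) f V p → MDiffAlongAt (E := E) f W p → P V → P W →
      P (fun q ↦ V q + W q))
    (hsmul : ∀ (a : M → ℝ) V, MDifferentiableAt 𝓘(ℝ, E) 𝓘(ℝ, ℝ) a p →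
      MDiffAlongAt (E := E) f V p → P V → P (fun q ↦ a q • V q))
    (hcomp : ∀ Z : (x : N) → TangentSpace 𝓘(ℝ, F) x, MDiffAt (T% Z) (f p) → P (fun q ↦ Z (f q)))
    (hV : MDiffAlongAt (E := E) f V p) : P V := by
  classical
  obtain ⟨hf, hc⟩ := mdiffAlongAt_iff.1 hV
  let b := Module.finBasis ℝ F
  let L : Fin (Module.finrank ℝ F) → F →L[ℝ] ℝ := fun k ↦
    LinearMap.toContinuousLinearMap (b.coord k)
  have hL (k) : MDifferentiableAt 𝓘(ℝ, E) 𝓘(ℝ, ℝ) (fun q ↦ L k (alongCoord f V p q)) p :=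
    (L k).mdifferentiableAt.comp p hc
  have hb (k) := MDiffAlongAt.of_comp hf (mdifferentiableAt_coordField (f p) (b k))
  -- Near `p` the field `V` is the sum of its coordinates times restricted coordinate fields. The
  -- empty partial sum is the restriction of the zero field.
  have key (t : Finset (Fin (Module.finrank ℝ F))) :
      MDiffAlongAt (E := E) f
        (fun q ↦ ∑ k ∈ t, L k (alongCoord f V p q) • coordField (f p) (b k) (f q)) p ∧
      P (fun q ↦ ∑ k ∈ t, L k (alongCoord f V p q) • coordField (f p) (b k) (f q)) := by
    induction t using Finset.induction_on with
    | empty =>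
      have h0 : MDiffAt (T% (fun y : N ↦ (0 : TangentSpace 𝓘(ℝ, F) y))) (f p) :=
        mdifferentiableAt_zeroSection ..
      simp only [Finset.sum_empty]
      exact ⟨.of_comp hf h0, hcomp _ h0⟩
    | insert k t hk ih =>
      simp only [Finset.sum_insert hk]
      exact ⟨.add (.smul (hL k) (hb k)) ih.1, hadd _ _ (.smul (hL k) (hb k)) ih.1
        (hsmul _ _ (hL k) (hb k) (hcomp _ (mdifferentiableAt_coordField (f p) (b k)))) ih.2⟩
  refine hcongr _ _ ?_ (key Finset.univ).2
  filter_upwards [eventually_mem_baseSet hf] with q hq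
  rw [← coordField_alongCoord (V := V) hq]
  conv_rhs => rw [← b.sum_equivFun (alongCoord f V p q)]
  simp only [coordField, ← Trivialization.symmₗ_apply (R := ℝ) _ hq, map_sum, map_smul]
  rfl

theorem covDerivAlong_of_comp (hf : MDifferentiableAt 𝓘(ℝ, E) 𝓘(ℝ, F) f p)
    {Z : (x : N) → TangentSpace 𝓘(ℝ, F) x} (hZ : MDiffAt (T% Z) (f p))
    (u : TangentSpace 𝓘(ℝ, E) p) :
    covDerivAlong cov f (fun q ↦ Z (f q)) p u =
      cov Z (f p) (mfderiv 𝓘(ℝ, E) 𝓘(ℝ, F) f p u) :=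
  covDerivAlong_comp cov hf Z hZ _ (.of_forall fun _ ↦ rfl) u

section Riemannian

variable [RiemannianBundle (fun x : N ↦ TangentSpace 𝓘(ℝ, F) x)] {s : ℕ}

omit [FiniteDimensional ℝ F] in
theorem MDiffAlongAt.φ (S : MetricFStructure F N s) (hV : MDiffAlongAt (E := E) f V p) :
    MDiffAlongAt (E := E) f (fun q ↦ S.φ (f q) (V q)) p :=
  MDifferentiableAt.clm_bundle_apply (((S.contMDiff_φ (f p)).mdifferentiableAt (by simp)).comp p
    hV.mdifferentiableAt) hV

/-- The Leibniz rule `∇_u (φ V) = (∇_u φ) V + φ (∇_u V)` for a vector field `V` along `f`. -/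
theorem covDerivAlong_φ (S : MetricFStructure F N s) (hV : MDiffAlongAt (E := E) f V p)
    (u : TangentSpace 𝓘(ℝ, E) p) :
    covDerivAlong cov f (fun q ↦ S.φ (f q) (V q)) p u =
      S.nablaφ cov (f p) (V p) (mfderiv 𝓘(ℝ, E) 𝓘(ℝ, F) f p u) +
        S.φ (f p) (covDerivAlong cov f V p u) := by
  refine MDiffAlongAt.induction (P := fun V ↦ covDerivAlong cov f (fun q ↦ S.φ (f q) (V q)) p u =
      S.nablaφ cov (f p) (V p) (mfderiv 𝓘(ℝ, E) 𝓘(ℝ, F) f p u) +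
        S.φ (f p) (covDerivAlong cov f V p u)) ?_ ?_ ?_ ?_ hV
  · intro V W h hP
    rw [← covDerivAlong_congr h, ← h.self_of_nhds, ← hP]
    exact (covDerivAlong_congr (h.mono fun q hq ↦ by rw [hq]) u).symm
  · intro V W hV hW h1 h2
    simp only [map_add]
    rw [covDerivAlong_add (hV.φ S) (hW.φ S), covDerivAlong_add hV hW, h1, h2, map_add, add_apply]
    abel
  · intro a V ha hV h
    simp only [map_smul]
    rw [covDerivAlong_smul ha (hV.φ S), covDerivAlong_smul ha hV, h, map_add, map_smul, map_smul,
      smul_apply, smul_add]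
    abel
  · intro Z hZ
    have hf := hV.mdifferentiableAt
    rw [covDerivAlong_of_comp hf hZ, ← S.cov_φ hZ]
    exact covDerivAlong_of_comp hf (S.mdifferentiableAt_φ hZ) u

variable [IsContMDiffRiemannianBundle 𝓘(ℝ, F) ∞ F (fun x : N ↦ TangentSpace 𝓘(ℝ, F) x)]

omit [FiniteDimensional ℝ F] in
theorem MDiffAlongAt.inner (hV : MDiffAlongAt (E := E) f V p)
    (hW : MDiffAlongAt (E := E) f W p) :
    MDifferentiableAt 𝓘(ℝ, E) 𝓘(ℝ, ℝ) (fun q ↦ inner ℝ (V q) (W q)) p :=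
  MDifferentiableAt.inner_bundle (IB := 𝓘(ℝ, F)) (F := F)
    (E := (fun x : N ↦ TangentSpace 𝓘(ℝ, F) x)) hV hW

/-- The induced connection on vector fields along `f` is compatible with the metric. -/
theorem IsLeviCivita.mvfderiv_inner_along (hcov : IsLeviCivita cov)
    (hV : MDiffAlongAt (E := E) f V p) (hW : MDiffAlongAt (E := E) f W p)
    (u : TangentSpace 𝓘(ℝ, E) p) :
    mvfderiv 𝓘(ℝ, E) (fun q ↦ inner ℝ (V q) (W q)) p u =
      inner ℝ (covDerivAlong cov f V p u) (W p) + inner ℝ (V p) (covDerivAlong cov f W p u) := by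
  have hf := hV.mdifferentiableAt
  refine MDiffAlongAt.induction (P := fun V ↦
    mvfderiv 𝓘(ℝ, E) (fun q ↦ inner ℝ (V q) (W q)) p u =
      inner ℝ (covDerivAlong cov f V p u) (W p) +
        inner ℝ (V p) (covDerivAlong cov f W p u)) ?_ ?_ ?_ ?_ hV
  · intro V V' h hP
    rw [← covDerivAlong_congr h, ← h.self_of_nhds, ← hP]
    have e : (fun q ↦ inner ℝ (V q) (W q)) =ᶠ[𝓝 p] fun q ↦ inner ℝ (V' q) (W q) :=
      h.mono fun q hq ↦ by simp only [hq]
    rw [mvfderiv_congr e]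
  · intro V V' hV hV' h1 h2
    simp only [inner_add_left]
    rw [mvfderiv_fun_add (hV.inner hW) (hV'.inner hW), add_apply, covDerivAlong_add hV hV', h1, h2,
      inner_add_left]
    ring
  · intro a V ha hV h
    simp only [real_inner_smul_left]
    rw [mvfderiv_fun_mul ha (hV.inner hW), add_apply, smul_apply, smul_apply,
      covDerivAlong_smul ha hV, h, inner_add_left, real_inner_smul_left, real_inner_smul_left,
      smul_eq_mul, smul_eq_mul]
    ring
  -- With the first argument now the restriction of `Z`, a second induction treats `W`.
  intro Z hZ
  have hZf := MDiffAlongAt.of_comp hf hZ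
  refine MDiffAlongAt.induction (P := fun W ↦
    mvfderiv 𝓘(ℝ, E) (fun q ↦ inner ℝ (Z (f q)) (W q)) p u =
      inner ℝ (covDerivAlong cov f (fun q ↦ Z (f q)) p u) (W p) +
        inner ℝ (Z (f p)) (covDerivAlong cov f W p u)) ?_ ?_ ?_ ?_ hW
  · intro W W' h hP
    rw [← covDerivAlong_congr h, ← h.self_of_nhds, ← hP]
    have e : (fun q ↦ inner ℝ (Z (f q)) (W q)) =ᶠ[𝓝 p] fun q ↦ inner ℝ (Z (f q)) (W' q) :=
      h.mono fun q hq ↦ by simp only [hq]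
    rw [mvfderiv_congr e]
  · intro W W' hW hW' h1 h2
    simp only [inner_add_right]
    rw [mvfderiv_fun_add (hZf.inner hW) (hZf.inner hW'), add_apply, covDerivAlong_add hW hW', h1,
      h2, inner_add_right]
    ring
  · intro a W ha hW h
    simp only [real_inner_smul_right]
    rw [mvfderiv_fun_mul ha (hZf.inner hW), add_apply, smul_apply, smul_apply,
      covDerivAlong_smul ha hW, h, inner_add_right, real_inner_smul_right, real_inner_smul_right,
      smul_eq_mul, smul_eq_mul]
    ring
  -- For two restrictions the claim is metric compatibility on `N` and the chain rule.
  intro W hW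
  rw [covDerivAlong_of_comp hf hZ, covDerivAlong_of_comp hf hW]
  have h := hcov.dirDeriv_inner
    (X := FiberBundle.extend F (mfderiv 𝓘(ℝ, E) 𝓘(ℝ, F) f p u)) hZ hW
  simp only [dirDeriv, FiberBundle.extend_apply_self] at h
  rw [← h]
  exact mvfderiv_comp_apply p (mdifferentiableAt_inner hZ hW) hf u

end Riemannian

end Along

/-! ### The Lie bracket as a commutator of derivations on vector-valued functions. -/

section Bracket

variable {E : Type*} [NormedAddCommGroup E] [NormedSpace ℝ E]
  {M : Type*} [TopologicalSpace M] [ChartedSpace E M] [IsManifold 𝓘(ℝ, E) ∞ M]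
  {G : Type*} [NormedAddCommGroup G] [NormedSpace ℝ G]
  {h : M → G} {p : M} {X Y : (q : M) → TangentSpace 𝓘(ℝ, E) q}

theorem mvfderiv_eq_fderiv_of_eventuallyEq {k : E → G}
    (hk : DifferentiableAt ℝ k (extChartAt 𝓘(ℝ, E) p p))
    (hhk : h =ᶠ[𝓝 p] k ∘ extChartAt 𝓘(ℝ, E) p) (u : TangentSpace 𝓘(ℝ, E) p) :
    mvfderiv 𝓘(ℝ, E) h p u = fderiv ℝ k (extChartAt 𝓘(ℝ, E) p p) u := by
  have hψ : MDifferentiableAt 𝓘(ℝ, E) 𝓘(ℝ, E) (extChartAt 𝓘(ℝ, E) p) p :=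
    (contMDiffAt_extChartAt (I := 𝓘(ℝ, E)) (n := ∞) (x := p)).mdifferentiableAt (by simp)
  have h1 := mfderiv_comp p hk.mdifferentiableAt hψ
  rw [mvfderiv_congr hhk, mvfderiv, h1, mfderiv_extChartAt_self, mfderiv_eq_fderiv]
  rfl

theorem contMDiffAt_extChartAt_symm_of_mem {z : E} (hz : z ∈ (extChartAt 𝓘(ℝ, E) p).target) :
    ContMDiffAt 𝓘(ℝ, E) 𝓘(ℝ, E) ∞ (extChartAt 𝓘(ℝ, E) p).symm z :=
  (contMDiffOn_extChartAt_symm p).contMDiffAt ((isOpen_extChartAt_target p).mem_nhds hz)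

theorem contDiffAt_comp_extChartAt_symm (hh : ContMDiffAt 𝓘(ℝ, E) 𝓘(ℝ, G) ∞ h p) :
    ContDiffAt ℝ ∞ (h ∘ (extChartAt 𝓘(ℝ, E) p).symm) (extChartAt 𝓘(ℝ, E) p p) :=
  contMDiffAt_iff_contDiffAt.1 (ContMDiffAt.comp_of_eq hh
    (contMDiffAt_extChartAt_symm_of_mem (mem_extChartAt_target p)) (extChartAt_to_inv p))

/-- The vector field `X` read in the preferred chart at `p`. -/
def chartField (X : (q : M) → TangentSpace 𝓘(ℝ, E) q) (p : M) : E → E :=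
  mpullbackWithin 𝓘(ℝ, E) 𝓘(ℝ, E) (extChartAt 𝓘(ℝ, E) p).symm X (Set.range 𝓘(ℝ, E))

theorem chartField_self (X : (q : M) → TangentSpace 𝓘(ℝ, E) q) (p : M) :
    chartField X p (extChartAt 𝓘(ℝ, E) p p) = X p := by
  have h : ∀ q, q = p → (X q : E) = X p := by
    rintro _ rfl
    rfl
  exact (mfderivWithin_extChartAt_symm_inverse_apply (I := 𝓘(ℝ, E)) (x := p)
    (X ((extChartAt 𝓘(ℝ, E) p).symm (extChartAt 𝓘(ℝ, E) p p)))).trans (h _ (extChartAt_to_inv p))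

theorem mfderiv_chartField {z : E} (hz : z ∈ (extChartAt 𝓘(ℝ, E) p).target) :
    mfderiv 𝓘(ℝ, E) 𝓘(ℝ, E) (extChartAt 𝓘(ℝ, E) p).symm z (chartField (E := E) X p z) =
      X ((extChartAt 𝓘(ℝ, E) p).symm z) := by
  have h := isInvertible_mfderivWithin_extChartAt_symm hz
  have e : mfderivWithin 𝓘(ℝ, E) 𝓘(ℝ, E) (extChartAt 𝓘(ℝ, E) p).symm (Set.range 𝓘(ℝ, E)) z =
      mfderiv 𝓘(ℝ, E) 𝓘(ℝ, E) (extChartAt 𝓘(ℝ, E) p).symm z := by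
    rw [modelWithCornersSelf_coe, Set.range_id, mfderivWithin_univ]
  rw [← e]
  exact h.self_apply_inverse _

omit [IsManifold 𝓘(ℝ, E) ∞ M] in
theorem preimage_univ_inter_range (p : M) :
    ((extChartAt 𝓘(ℝ, E) p).symm ⁻¹' Set.univ) ∩ Set.range 𝓘(ℝ, E) = Set.univ := by
  simp

/-- The equality is needed on a neighbourhood and not only at `p`, because it is differentiated once
more in `mvfderiv_mlieBracket`. -/
theorem fderiv_chartField (hh : ContMDiffAt 𝓘(ℝ, E) 𝓘(ℝ, G) ∞ h p) :
    (fun q ↦ mvfderiv 𝓘(ℝ, E) h q (X q)) =ᶠ[𝓝 p]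
      (fun z ↦ fderiv ℝ (h ∘ (extChartAt 𝓘(ℝ, E) p).symm) z (chartField X p z)) ∘
        extChartAt 𝓘(ℝ, E) p := by
  have h1 : ContMDiffAt 𝓘(ℝ, E) 𝓘(ℝ, G) 1 h p := hh.of_le (by simp)
  filter_upwards [(contMDiffAt_iff_contMDiffAt_nhds (by simp)).1 h1,
    extChartAt_source_mem_nhds (I := 𝓘(ℝ, E)) p] with q hq hs
  have hz := (extChartAt 𝓘(ℝ, E) p).map_source hs
  have hqs := (extChartAt 𝓘(ℝ, E) p).left_inv hs
  have h2 : mfderiv 𝓘(ℝ, E) 𝓘(ℝ, G) (h ∘ (extChartAt 𝓘(ℝ, E) p).symm)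
      (extChartAt 𝓘(ℝ, E) p q) = _ :=
    mfderiv_comp _ (by rw [hqs]; exact hq.mdifferentiableAt (by simp))
      ((contMDiffAt_extChartAt_symm_of_mem hz).mdifferentiableAt (by simp))
  rw [mfderiv_eq_fderiv] at h2
  have h3 : ∀ r, r = q → (mfderiv 𝓘(ℝ, E) 𝓘(ℝ, G) h r (X r) : G) =
      mfderiv 𝓘(ℝ, E) 𝓘(ℝ, G) h q (X q) := by
    rintro _ rfl
    rfl
  have h4 := congrArg (fun L : E →L[ℝ] G ↦ L (chartField X p (extChartAt 𝓘(ℝ, E) p q))) h2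
  have h5 := congrArg (mfderiv 𝓘(ℝ, E) 𝓘(ℝ, G) h ((extChartAt 𝓘(ℝ, E) p).symm
    (extChartAt 𝓘(ℝ, E) p q))) (mfderiv_chartField (X := X) hz)
  exact ((h4.trans h5).trans (h3 _ hqs)).symm

variable [FiniteDimensional ℝ E]

theorem differentiableAt_chartField (hX : MDiffAt (T% X) p) :
    DifferentiableAt ℝ (chartField X p) (extChartAt 𝓘(ℝ, E) p p) := by
  have : CompleteSpace E := FiniteDimensional.complete ℝ E
  have h : DifferentiableWithinAt ℝ (chartField X p)
      (((extChartAt 𝓘(ℝ, E) p).symm ⁻¹' Set.univ) ∩ Set.range 𝓘(ℝ, E))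
      (extChartAt 𝓘(ℝ, E) p p) :=
    MDifferentiableWithinAt.differentiableWithinAt_mpullbackWithin_vectorField
      (s := Set.univ) (V := X) (x := p) hX.mdifferentiableWithinAt
  rwa [preimage_univ_inter_range, differentiableWithinAt_univ] at h

-- The bracket on `M` is the chart bracket transported by the inverse derivative of the preferred
-- chart, which is the identity at the centre `p`.
omit [FiniteDimensional ℝ E] in
theorem mlieBracket_eq_chartField (X Y : (q : M) → TangentSpace 𝓘(ℝ, E) q) (p : M) :
    mlieBracket 𝓘(ℝ, E) X Y p =
      lieBracket (E := E) ℝ (chartField X p) (chartField Y p) (extChartAt 𝓘(ℝ, E) p p) := by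
  have h : mlieBracket 𝓘(ℝ, E) X Y p =
      (mfderiv 𝓘(ℝ, E) 𝓘(ℝ, E) (extChartAt 𝓘(ℝ, E) p) p : E →L[ℝ] E).inverse
        (lieBracketWithin (E := E) ℝ (chartField X p) (chartField Y p)
          (((extChartAt 𝓘(ℝ, E) p).symm ⁻¹' Set.univ) ∩ Set.range 𝓘(ℝ, E))
          (extChartAt 𝓘(ℝ, E) p p)) :=
    mlieBracketWithin_apply
  have e : (mfderiv 𝓘(ℝ, E) 𝓘(ℝ, E) (extChartAt 𝓘(ℝ, E) p) p : E →L[ℝ] E) =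
    ContinuousLinearMap.id ℝ E := mfderiv_extChartAt_self
  have key : ∀ L : E →L[ℝ] E, L = ContinuousLinearMap.id ℝ E → ∀ v, L.inverse v = v := by
    rintro _ rfl v
    simp
  rw [preimage_univ_inter_range, lieBracketWithin_univ] at h
  exact h.trans (key _ e _)

/-- The Lie bracket acts on functions as the commutator of the derivations. -/
theorem mvfderiv_mlieBracket (hh : ContMDiffAt 𝓘(ℝ, E) 𝓘(ℝ, G) ∞ h p)
    (hX : MDiffAt (T% X) p) (hY : MDiffAt (T% Y) p) :
    mvfderiv 𝓘(ℝ, E) h p (mlieBracket 𝓘(ℝ, E) X Y p) =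
      mvfderiv 𝓘(ℝ, E) (fun q ↦ mvfderiv 𝓘(ℝ, E) h q (Y q)) p (X p) -
        mvfderiv 𝓘(ℝ, E) (fun q ↦ mvfderiv 𝓘(ℝ, E) h q (X q)) p (Y p) := by
  have hc := contDiffAt_comp_extChartAt_symm hh
  have hX' := differentiableAt_chartField hX
  have hY' := differentiableAt_chartField hY
  have hd : DifferentiableAt ℝ (fderiv ℝ (h ∘ (extChartAt 𝓘(ℝ, E) p).symm))
      (extChartAt 𝓘(ℝ, E) p p) :=
    (hc.fderiv_right (m := 1) (by norm_cast)).differentiableAt (by simp)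
  have hi : h =ᶠ[𝓝 p] (h ∘ (extChartAt 𝓘(ℝ, E) p).symm) ∘ extChartAt 𝓘(ℝ, E) p := by
    filter_upwards [extChartAt_source_mem_nhds (I := 𝓘(ℝ, E)) p] with q hq
    simp only [Function.comp_apply, (extChartAt 𝓘(ℝ, E) p).left_inv hq]
  have hl := fderiv_apply_lieBracket (𝕜 := ℝ) hc (by simp; norm_cast) hY' hX'
  rw [chartField_self, chartField_self] at hl
  rw [mvfderiv_eq_fderiv_of_eventuallyEq (hd.clm_apply hY') (fderiv_chartField hh),
    mvfderiv_eq_fderiv_of_eventuallyEq (hd.clm_apply hX') (fderiv_chartField hh),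
    mvfderiv_eq_fderiv_of_eventuallyEq (hc.differentiableAt (by simp)) hi,
    mlieBracket_eq_chartField]
  exact hl

end Bracket

/-! ### Torsion-freeness of the induced connection. -/

section Differential

variable {E : Type*} [NormedAddCommGroup E] [NormedSpace ℝ E]
  {M : Type*} [TopologicalSpace M] [ChartedSpace E M] [IsManifold 𝓘(ℝ, E) ∞ M]
  {F : Type*} [NormedAddCommGroup F] [NormedSpace ℝ F]
  {N : Type*} [TopologicalSpace N] [ChartedSpace F N] [IsManifold 𝓘(ℝ, F) ∞ N]
  {f : M → N} {p : M} {X Y : (q : M) → TangentSpace 𝓘(ℝ, E) q}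

theorem mdiffAlongAt_mfderiv (hf : ContMDiff 𝓘(ℝ, E) 𝓘(ℝ, F) ∞ f) (hY : MDiffAt (T% Y) p) :
    MDiffAlongAt (E := E) f (fun q ↦ mfderiv 𝓘(ℝ, E) 𝓘(ℝ, F) f q (Y q)) p := by
  have h := hf.contMDiff_tangentMap (m := 1) (by norm_cast)
  exact MDifferentiableAt.comp (f := T% Y) p ((h _).mdifferentiableAt (by simp)) hY

-- The preferred trivialization of the tangent bundle is the derivative of the chart. Coordinates of
-- `df Y` are thus derivatives of one `F`-valued function, to which `mvfderiv_mlieBracket` applies.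
omit [IsManifold 𝓘(ℝ, E) ∞ M] in
theorem alongCoord_mfderiv (hf : ContMDiff 𝓘(ℝ, E) 𝓘(ℝ, F) ∞ f) :
    alongCoord f (fun q ↦ mfderiv 𝓘(ℝ, E) 𝓘(ℝ, F) f q (Y q)) p =ᶠ[𝓝 p]
      fun q ↦ mvfderiv 𝓘(ℝ, E) (extChartAt 𝓘(ℝ, F) (f p) ∘ f) q (Y q) := by
  have hd := hf.mdifferentiable (by simp)
  filter_upwards [eventually_mem_baseSet (hd p)] with q hq
  have hs : f q ∈ (chartAt F (f p)).source := hq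
  have h1 : ContMDiffAt 𝓘(ℝ, F) 𝓘(ℝ, F) ∞ (extChartAt 𝓘(ℝ, F) (f p)) (f q) :=
    contMDiffAt_extChartAt' hs
  rw [alongCoord_eq hq, TangentBundle.continuousLinearMapAt_trivializationAt hs, mvfderiv,
    mfderiv_comp q (h1.mdifferentiableAt (by simp)) (hd q)]
  rfl

variable [FiniteDimensional ℝ E] [FiniteDimensional ℝ F]
  [RiemannianBundle (fun x : N ↦ TangentSpace 𝓘(ℝ, F) x)]
  [IsContMDiffRiemannianBundle 𝓘(ℝ, F) ∞ F (fun x : N ↦ TangentSpace 𝓘(ℝ, F) x)]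
  {cov : CovariantDerivative 𝓘(ℝ, F) F (fun x : N ↦ TangentSpace 𝓘(ℝ, F) x)}

/-- Symmetry of the Christoffel symbols: the chart has constant derivative along coordinate fields,
so their bracket vanishes at `x`. -/
theorem cov_coordField_comm (hcov : IsLeviCivita cov) (x : N) (v w : F) :
    cov (coordField x v) x (coordField x w x) = cov (coordField x w) x (coordField x v x) := by
  have hv := mdifferentiableAt_coordField x v
  have hw := mdifferentiableAt_coordField x w
  have h := hcov.sub_eq_mlieBracket hw hv
  have hc : ContMDiffAt 𝓘(ℝ, F) 𝓘(ℝ, F) ∞ (extChartAt 𝓘(ℝ, F) x) x := contMDiffAt_extChartAt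
  have hb := mvfderiv_mlieBracket hc hw hv
  have hcst (v : F) : (fun y ↦ mvfderiv 𝓘(ℝ, F) (extChartAt 𝓘(ℝ, F) x) y (coordField x v y))
      =ᶠ[𝓝 x] fun _ ↦ v := by
    filter_upwards [eventually_mem_baseSet_self (F := F) x] with y hy
    have := TangentBundle.continuousLinearMapAt_trivializationAt (I := 𝓘(ℝ, F)) (x₀ := x)
      (x := y) hy
    rw [mvfderiv, ← this]
    change Trivialization.continuousLinearMapAt ℝ _ y (coordField x v y) = v
    rw [coordField, Trivialization.continuousLinearMapAt_apply,
      Trivialization.coe_linearMapAt_of_mem _ hy]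
    exact congrArg Prod.snd (Trivialization.apply_mk_symm _ hy v)
  rw [mvfderiv_congr (hcst v), mvfderiv_congr (hcst w), mvfderiv_const, mvfderiv_const, ← h,
    mvfderiv, mfderiv_extChartAt_self, zero_apply, zero_apply, sub_zero] at hb
  exact sub_eq_zero.1 hb

/-- The induced connection on vector fields along `f` is torsion-free. -/
theorem IsLeviCivita.covDerivAlong_sub (hcov : IsLeviCivita cov)
    (hf : ContMDiff 𝓘(ℝ, E) 𝓘(ℝ, F) ∞ f) (hX : MDiffAt (T% X) p) (hY : MDiffAt (T% Y) p) :
    covDerivAlong cov f (fun q ↦ mfderiv 𝓘(ℝ, E) 𝓘(ℝ, F) f q (Y q)) p (X p) -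
        covDerivAlong cov f (fun q ↦ mfderiv 𝓘(ℝ, E) 𝓘(ℝ, F) f q (X q)) p (Y p) =
      mfderiv 𝓘(ℝ, E) 𝓘(ℝ, F) f p (mlieBracket 𝓘(ℝ, E) X Y p) := by
  have hc : ContMDiffAt 𝓘(ℝ, E) 𝓘(ℝ, F) ∞ (extChartAt 𝓘(ℝ, F) (f p) ∘ f) p :=
    contMDiffAt_extChartAt.comp p (hf p)
  have hb := mvfderiv_mlieBracket hc hX hY
  have eX := alongCoord_mfderiv (p := p) (Y := X) hf
  have eY := alongCoord_mfderiv (p := p) (Y := Y) hf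
  have e := (alongCoord_mfderiv (p := p) (Y := fun q ↦ mlieBracket 𝓘(ℝ, E) X Y q) hf).self_of_nhds
  rw [← mvfderiv_congr eX, ← mvfderiv_congr eY] at hb
  have hX' := coordField_alongCoord (V := fun q ↦ mfderiv 𝓘(ℝ, E) 𝓘(ℝ, F) f q (X q))
    (mem_baseSet (f p))
  have hY' := coordField_alongCoord (V := fun q ↦ mfderiv 𝓘(ℝ, E) 𝓘(ℝ, F) f q (Y q))
    (mem_baseSet (f p))
  have hXY := coordField_alongCoord
    (V := fun q ↦ mfderiv 𝓘(ℝ, E) 𝓘(ℝ, F) f q (mlieBracket 𝓘(ℝ, E) X Y q)) (mem_baseSet (f p))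
  -- The Christoffel parts of the two covariant derivatives agree, and the derivatives of the
  -- coordinates differ by the coordinates of `df [X, Y]`.
  rw [covDerivAlong_eq, covDerivAlong_eq, ← hXY, e.trans hb, ← hX', ← hY', cov_coordField_comm hcov,
    add_sub_add_right_eq_sub, sub_eq_iff_eq_add, ← coordField_add (mem_baseSet (f p)),
    sub_add_cancel]

end Differential

/-! ### Differentiability of a field on `M` from that of its image under an immersion. -/

section Immersion

variable {E : Type*} [NormedAddCommGroup E] [NormedSpace ℝ E]
  {M : Type*} [TopologicalSpace M] [ChartedSpace E M] [IsManifold 𝓘(ℝ, E) ∞ M]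
  {F : Type*} [NormedAddCommGroup F] [NormedSpace ℝ F]
  {N : Type*} [TopologicalSpace N] [ChartedSpace F N] [IsManifold 𝓘(ℝ, F) ∞ N]
  {f : M → N} {p : M}

theorem inTangentCoordinates_mfderiv_apply (hf : MDifferentiableAt 𝓘(ℝ, E) 𝓘(ℝ, F) f p)
    (Z : (q : M) → TangentSpace 𝓘(ℝ, E) q) :
    (fun q ↦ inTangentCoordinates 𝓘(ℝ, E) 𝓘(ℝ, F) id f (mfderiv 𝓘(ℝ, E) 𝓘(ℝ, F) f) p q
      (alongCoord (F := E) id Z p q)) =ᶠ[𝓝 p]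
      alongCoord f (fun q ↦ mfderiv 𝓘(ℝ, E) 𝓘(ℝ, F) f q (Z q)) p := by
  filter_upwards [eventually_mem_baseSet hf, eventually_mem_baseSet_self (F := E) p] with q hq hq'
  rw [alongCoord_eq hq, alongCoord_eq (f := id) hq']
  refine congrArg (fun z ↦ Trivialization.continuousLinearMapAt ℝ _ (f q)
    (mfderiv 𝓘(ℝ, E) 𝓘(ℝ, F) f q z)) ?_
  exact (trivializationAt E (fun x : M ↦ TangentSpace 𝓘(ℝ, E) x) p).symmL_continuousLinearMapAt
    (R := ℝ) hq' (Z q)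

/-- If `f` is an immersion at `p` and `df Z` is differentiable along `f` at `p`, then so is `Z`. -/
theorem mdifferentiableAt_of_mdiffAlongAt_mfderiv [FiniteDimensional ℝ E] [FiniteDimensional ℝ F]
    (hf : ContMDiff 𝓘(ℝ, E) 𝓘(ℝ, F) ∞ f)
    (hinj : Function.Injective (mfderiv 𝓘(ℝ, E) 𝓘(ℝ, F) f p))
    {Z : (q : M) → TangentSpace 𝓘(ℝ, E) q}
    (hZ : MDiffAlongAt (E := E) f (fun q ↦ mfderiv 𝓘(ℝ, E) 𝓘(ℝ, F) f q (Z q)) p) :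
    MDiffAt (T% Z) p := by
  have : CompleteSpace (E →L[ℝ] E) := FiniteDimensional.complete ℝ _
  refine (mdiffAlongAt_iff (F := E) (f := id)).2 ⟨mdifferentiableAt_id, ?_⟩
  obtain ⟨hd, hw⟩ := mdiffAlongAt_iff.1 hZ
  set A := inTangentCoordinates 𝓘(ℝ, E) 𝓘(ℝ, F) id f (mfderiv 𝓘(ℝ, E) 𝓘(ℝ, F) f) p
  have hAd : MDifferentiableAt 𝓘(ℝ, E) 𝓘(ℝ, E →L[ℝ] F) A p :=
    ((hf p).mfderiv_const (m := 1) (by norm_cast)).mdifferentiableAt (by simp)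
  have hAinj : Function.Injective (A p) := by
    have e := ContinuousLinearMap.inCoordinates_eq (ϕ := mfderiv 𝓘(ℝ, E) 𝓘(ℝ, F) f p)
      (mem_baseSet p) (mem_baseSet (f p))
    change Function.Injective (ContinuousLinearMap.inCoordinates E (TangentSpace 𝓘(ℝ, E)) F
      (TangentSpace 𝓘(ℝ, F)) p p (f p) (f p) (mfderiv 𝓘(ℝ, E) 𝓘(ℝ, F) f p))
    rw [e]
    exact (((trivializationAt F (TangentSpace 𝓘(ℝ, F)) (f p)).continuousLinearEquivAt ℝ (f p)
      (mem_baseSet (f p))).injective.comp hinj).comp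
      ((trivializationAt E (TangentSpace 𝓘(ℝ, E)) p).continuousLinearEquivAt ℝ p
        (mem_baseSet p)).symm.injective
  -- A left inverse `P` of `df` at `p` alone suffices: `P ∘ A q` is the identity at `p`, hence
  -- invertible nearby, and the coordinates of `Z` are `(P ∘ A q)⁻¹ P` applied to those of `df Z`.
  obtain ⟨g, hg⟩ := (A p).toLinearMap.exists_leftInverse_of_injective (LinearMap.ker_eq_bot.2 hAinj)
  let P : F →L[ℝ] E := LinearMap.toContinuousLinearMap g
  have hP : P ∘L A p = 1 := by
    ext v
    exact LinearMap.congr_fun hg v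
  let B : M → (E →L[ℝ] E) := fun q ↦ P ∘L A q
  have hB : MDifferentiableAt 𝓘(ℝ, E) 𝓘(ℝ, E →L[ℝ] E) B p :=
    (ContinuousLinearMap.compL ℝ E F E P).mdifferentiableAt.comp p hAd
  have hBp : IsUnit (B p) := by
    rw [show B p = 1 from hP]
    exact isUnit_one
  have hBi : MDifferentiableAt 𝓘(ℝ, E) 𝓘(ℝ, E →L[ℝ] E) (fun q ↦ Ring.inverse (B q)) p :=
    (differentiableAt_inverse (𝕜 := ℝ) hBp).mdifferentiableAt.comp p hB
  have hPw : MDifferentiableAt 𝓘(ℝ, E) 𝓘(ℝ, E) (fun q ↦ P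
      (alongCoord f (fun q ↦ mfderiv 𝓘(ℝ, E) 𝓘(ℝ, F) f q (Z q)) p q)) p :=
    P.mdifferentiableAt.comp p hw
  refine (hBi.clm_apply hPw).congr_of_eventuallyEq ?_
  filter_upwards [inTangentCoordinates_mfderiv_apply hd Z,
    hB.continuousAt (Units.isOpen.mem_nhds hBp)] with q hq hu
  rw [← hq]
  change _ = (Ring.inverse (B q) * B q) _
  rw [Ring.inverse_mul_cancel _ hu]
  rfl

end Immersion

/-! ### The second fundamental form of an invariant submanifold. -/

section Submanifold

variable {F : Type*} [NormedAddCommGroup F] [NormedSpace ℝ F] [FiniteDimensional ℝ F]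
  {N : Type*} [TopologicalSpace N] [ChartedSpace F N] [IsManifold 𝓘(ℝ, F) ∞ N]
  [RiemannianBundle (fun x : N ↦ TangentSpace 𝓘(ℝ, F) x)]
  [IsContMDiffRiemannianBundle 𝓘(ℝ, F) ∞ F (fun x : N ↦ TangentSpace 𝓘(ℝ, F) x)]
  {E : Type*} [NormedAddCommGroup E] [NormedSpace ℝ E] [FiniteDimensional ℝ E]
  {M : Type*} [TopologicalSpace M] [ChartedSpace E M] [IsManifold 𝓘(ℝ, E) ∞ M]
  [RiemannianBundle (fun p : M ↦ TangentSpace 𝓘(ℝ, E) p)]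
  [IsContMDiffRiemannianBundle 𝓘(ℝ, E) ∞ E (fun p : M ↦ TangentSpace 𝓘(ℝ, E) p)]
  {covN : CovariantDerivative 𝓘(ℝ, F) F (fun x : N ↦ TangentSpace 𝓘(ℝ, F) x)}
  {covM : CovariantDerivative 𝓘(ℝ, E) E (fun p : M ↦ TangentSpace 𝓘(ℝ, E) p)}
  {f : M → N} {p : M} {X Y Z : (q : M) → TangentSpace 𝓘(ℝ, E) q}

omit [FiniteDimensional ℝ F] [FiniteDimensional ℝ E] [IsManifold 𝓘(ℝ, E) ∞ M]
  [IsManifold 𝓘(ℝ, F) ∞ N]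
  [IsContMDiffRiemannianBundle 𝓘(ℝ, F) ∞ F (fun x : N ↦ TangentSpace 𝓘(ℝ, F) x)]
  [IsContMDiffRiemannianBundle 𝓘(ℝ, E) ∞ E (fun p : M ↦ TangentSpace 𝓘(ℝ, E) p)] in
theorem IsIsometricImmersion.injective_mfderiv (hf : IsIsometricImmersion (E := E) (F := F) f)
    (p : M) : Function.Injective (mfderiv 𝓘(ℝ, E) 𝓘(ℝ, F) f p) := by
  rw [injective_iff_map_eq_zero]
  intro u hu
  have h := hf.inner_mfderiv p u u
  rw [hu, inner_zero_left] at h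
  exact inner_self_eq_zero.1 h.symm

/-- Both connections are torsion-free, so both antisymmetrizations equal `df [X, Y]`. -/
theorem secondFundamentalForm_comm (hcovN : IsLeviCivita covN) (hcovM : IsLeviCivita covM)
    (hf : ContMDiff 𝓘(ℝ, E) 𝓘(ℝ, F) ∞ f) (hX : MDiffAt (T% X) p) (hY : MDiffAt (T% Y) p) :
    secondFundamentalForm covN covM f X Y p = secondFundamentalForm covN covM f Y X p := by
  have h := hcovN.covDerivAlong_sub hf hX hY
  rw [← hcovM.sub_eq_mlieBracket hX hY, map_sub] at h
  rw [secondFundamentalForm, secondFundamentalForm, sub_eq_sub_iff_sub_eq_sub, h]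

/-- The function `g(Y, Z)` is differentiated along `X` with either connection; `f` being isometric,
the results agree. -/
theorem inner_secondFundamentalForm_skew (hcovN : IsLeviCivita covN) (hcovM : IsLeviCivita covM)
    (hf : IsIsometricImmersion (E := E) (F := F) f) (hY : MDiffAt (T% Y) p)
    (hZ : MDiffAt (T% Z) p) :
    inner ℝ (secondFundamentalForm covN covM f X Y p) (mfderiv 𝓘(ℝ, E) 𝓘(ℝ, F) f p (Z p)) =
      -inner ℝ (secondFundamentalForm covN covM f X Z p) (mfderiv 𝓘(ℝ, E) 𝓘(ℝ, F) f p (Y p)) := by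
  have h := hcovN.mvfderiv_inner_along (mdiffAlongAt_mfderiv hf.contMDiff hY)
    (mdiffAlongAt_mfderiv hf.contMDiff hZ) (X p)
  simp only [hf.inner_mfderiv] at h
  have h' := hcovM.dirDeriv_inner (X := X) hY hZ
  rw [dirDeriv] at h'
  rw [h', real_inner_comm (covDerivAlong covN f _ p (X p))] at h
  simp only [secondFundamentalForm, inner_sub_left, hf.inner_mfderiv]
  rw [real_inner_comm (covM Z p (X p))] at h
  linarith

/-- The second fundamental form takes values in the normal bundle. -/
theorem inner_secondFundamentalForm_mfderiv (hcovN : IsLeviCivita covN)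
    (hcovM : IsLeviCivita covM) (hf : IsIsometricImmersion (E := E) (F := F) f)
    (hX : MDiffAt (T% X) p) (hY : MDiffAt (T% Y) p) (w : TangentSpace 𝓘(ℝ, E) p) :
    inner ℝ (secondFundamentalForm covN covM f X Y p) (mfderiv 𝓘(ℝ, E) 𝓘(ℝ, F) f p w) = 0 := by
  have hZ := FiberBundle.mdifferentiableAt_extend 𝓘(ℝ, E) E
    (V := fun x : M ↦ TangentSpace 𝓘(ℝ, E) x) w
  have e := FiberBundle.extend_apply_self (F := E) (E := fun x : M ↦ TangentSpace 𝓘(ℝ, E) x) w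
  set Z := FiberBundle.extend E (E := fun x : M ↦ TangentSpace 𝓘(ℝ, E) x) w
  rw [← e]
  have c1 := secondFundamentalForm_comm hcovN hcovM hf.contMDiff hX hY
  have c2 := secondFundamentalForm_comm hcovN hcovM hf.contMDiff hY hZ
  have c3 := secondFundamentalForm_comm hcovN hcovM hf.contMDiff hZ hX
  have s1 := inner_secondFundamentalForm_skew (X := X) hcovN hcovM hf hY hZ
  have s2 := inner_secondFundamentalForm_skew (X := Y) hcovN hcovM hf hZ hX
  have s3 := inner_secondFundamentalForm_skew (X := Z) hcovN hcovM hf hX hY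
  -- The trilinear expression `g(h(X, Y), df Z)` is symmetric in its first two arguments and skew in
  -- its last two, hence zero.
  rw [c1] at s1
  rw [c2] at s2
  rw [c3] at s3
  rw [c1]
  linarith

variable {n s : ℕ} {S : MetricFStructure F N s}

-- The field `φY` on `M` is chosen pointwise as a preimage under `df`, so its regularity comes from
-- that of its image `φ(df Y)`.
omit [IsContMDiffRiemannianBundle 𝓘(ℝ, F) ∞ F (fun x : N ↦ TangentSpace 𝓘(ℝ, F) x)]
  [IsContMDiffRiemannianBundle 𝓘(ℝ, E) ∞ E (fun p : M ↦ TangentSpace 𝓘(ℝ, E) p)] in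
theorem mdifferentiableAt_inducedφField (hf : IsIsometricImmersion (E := E) (F := F) f)
    (hinv : IsInvariantSubmanifold (E := E) S f) (hY : MDiffAt (T% Y) p) :
    MDiffAt (T% (inducedφField S f Y)) p := by
  refine mdifferentiableAt_of_mdiffAlongAt_mfderiv hf.contMDiff (hf.injective_mfderiv p) ?_
  simp only [inducedφField, mfderiv_inducedφ hinv]
  exact (mdiffAlongAt_mfderiv hf.contMDiff hY).φ S

theorem inner_φ_secondFundamentalForm_mfderiv (hS : S.IsGeneralizedAlmostKenmotsu n)
    (hcovN : IsLeviCivita covN)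
    (hcovM : IsLeviCivita covM) (hf : IsIsometricImmersion (E := E) (F := F) f)
    (hinv : IsInvariantSubmanifold (E := E) S f)
    (hX : MDiffAt (T% X) p) (hY : MDiffAt (T% Y) p) (w : TangentSpace 𝓘(ℝ, E) p) :
    inner ℝ (S.φ (f p) (secondFundamentalForm covN covM f X Y p))
      (mfderiv 𝓘(ℝ, E) 𝓘(ℝ, F) f p w) = 0 := by
  rw [hS.inner_φ_left, ← mfderiv_inducedφ hinv,
    inner_secondFundamentalForm_mfderiv hcovN hcovM hf hX hY, neg_zero]

omit [FiniteDimensional ℝ E]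
  [IsContMDiffRiemannianBundle 𝓘(ℝ, E) ∞ E (fun p : M ↦ TangentSpace 𝓘(ℝ, E) p)] in
/-- The tangential and the normal part of `∇̄_X (φY) = (∇̄_X φ)Y + φ ∇̄_X Y`. -/
theorem mfderiv_covDerivφ_add (hS : S.IsGeneralizedKenmotsu n) (hcovN : IsLeviCivita covN)
    (hf : IsIsometricImmersion (E := E) (F := F) f)
    (hinv : IsInvariantSubmanifold (E := E) S f) (hY : MDiffAt (T% Y) p) :
    mfderiv 𝓘(ℝ, E) 𝓘(ℝ, F) f p (covDerivφ S f covM X Y p) +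
        secondFundamentalForm covN covM f X (inducedφField S f Y) p =
      mfderiv 𝓘(ℝ, E) 𝓘(ℝ, F) f p (∑ i,
          (inner ℝ (inducedφ S f p (X p)) (Y p) • inducedξ S f i p
            - inducedη S f i p (Y p) • inducedφ S f p (X p))) +
        S.φ (f p) (secondFundamentalForm covN covM f X Y p) := by
  have h := covDerivAlong_φ (cov := covN) S (mdiffAlongAt_mfderiv hf.contMDiff hY) (X p)
  rw [hS.nablaφ_eq hcovN] at h
  simp only [secondFundamentalForm, covDerivφ, map_sub, map_sum, map_smul, inducedφField,
    mfderiv_inducedφ hinv, mfderiv_inducedξ hinv, inducedη]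
  rw [h]
  have e : inner ℝ (inducedφ S f p (X p)) (Y p) = inner ℝ
      (S.φ (f p) (mfderiv 𝓘(ℝ, E) 𝓘(ℝ, F) f p (X p))) (mfderiv 𝓘(ℝ, E) 𝓘(ℝ, F) f p (Y p)) := by
    rw [← mfderiv_inducedφ hinv, hf.inner_mfderiv]
  rw [e]
  abel

/-- The difference `d` of the two sides is normal, and by `mfderiv_covDerivφ_add` it is also
tangent, so it is orthogonal to itself. -/
theorem secondFundamentalForm_inducedφField_right (hS : S.IsGeneralizedKenmotsu n)
    (hcovN : IsLeviCivita covN) (hcovM : IsLeviCivita covM)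
    (hf : IsIsometricImmersion (E := E) (F := F) f)
    (hinv : IsInvariantSubmanifold (E := E) S f)
    (hX : MDiffAt (T% X) p) (hY : MDiffAt (T% Y) p) :
    secondFundamentalForm covN covM f X (inducedφField S f Y) p =
      S.φ (f p) (secondFundamentalForm covN covM f X Y p) := by
  have h := mfderiv_covDerivφ_add (covM := covM) (X := X) hS hcovN hf hinv hY
  rw [← sub_eq_zero]
  set d := secondFundamentalForm covN covM f X (inducedφField S f Y) p -
    S.φ (f p) (secondFundamentalForm covN covM f X Y p) with hd
  have hdw (w : TangentSpace 𝓘(ℝ, E) p) : inner ℝ d (mfderiv 𝓘(ℝ, E) 𝓘(ℝ, F) f p w) = 0 := by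
    rw [hd, inner_sub_left,
      inner_φ_secondFundamentalForm_mfderiv hS.almost hcovN hcovM hf hinv hX hY,
      inner_secondFundamentalForm_mfderiv hcovN hcovM hf hX
        (mdifferentiableAt_inducedφField hf hinv hY), sub_zero]
  have hdt : d = mfderiv 𝓘(ℝ, E) 𝓘(ℝ, F) f p ((∑ i,
      (inner ℝ (inducedφ S f p (X p)) (Y p) • inducedξ S f i p
        - inducedη S f i p (Y p) • inducedφ S f p (X p))) - covDerivφ S f covM X Y p) := by
    rw [map_sub, hd, sub_eq_sub_iff_add_eq_add, add_comm, h]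
  rw [← inner_self_eq_zero (𝕜 := ℝ)]
  nth_rewrite 2 [hdt]
  exact hdw _

theorem η_secondFundamentalForm (hS : S.IsGeneralizedAlmostKenmotsu n)
    (hcovN : IsLeviCivita covN) (hcovM : IsLeviCivita covM)
    (hf : IsIsometricImmersion (E := E) (F := F) f)
    (hinv : IsInvariantSubmanifold (E := E) S f)
    (hX : MDiffAt (T% X) p) (hY : MDiffAt (T% Y) p) (i : Fin s) :
    S.η i (f p) (secondFundamentalForm covN covM f X Y p) = 0 := by
  rw [← hS.inner_ξ, ← mfderiv_inducedξ hinv,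
    inner_secondFundamentalForm_mfderiv hcovN hcovM hf hX hY]

end Submanifold

end GenKenmotsu

end

theorem mainTheorem4
    {F : Type*} [NormedAddCommGroup F] [NormedSpace ℝ F] [FiniteDimensional ℝ F]
    {N : Type*} [TopologicalSpace N] [ChartedSpace F N] [IsManifold 𝓘(ℝ, F) ∞ N]
    [RiemannianBundle (fun x : N ↦ TangentSpace 𝓘(ℝ, F) x)]
    [IsContMDiffRiemannianBundle 𝓘(ℝ, F) ∞ F (fun x : N ↦ TangentSpace 𝓘(ℝ, F) x)]
    {E : Type*} [NormedAddCommGroup E] [NormedSpace ℝ E] [FiniteDimensional ℝ E]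
    {M : Type*} [TopologicalSpace M] [ChartedSpace E M] [IsManifold 𝓘(ℝ, E) ∞ M]
    [RiemannianBundle (fun p : M ↦ TangentSpace 𝓘(ℝ, E) p)]
    [IsContMDiffRiemannianBundle 𝓘(ℝ, E) ∞ E (fun p : M ↦ TangentSpace 𝓘(ℝ, E) p)]
    (n s : ℕ) (S : MetricFStructure F N s) (hS : S.IsGeneralizedKenmotsu n)
    (covN : CovariantDerivative 𝓘(ℝ, F) F (fun x : N ↦ TangentSpace 𝓘(ℝ, F) x))
    (hcovN : IsLeviCivita covN)
    (f : M → N) (hf : IsIsometricImmersion (E := E) (F := F) f) (hinv : IsInvariantSubmanifold (E := E) S f)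
    (covM : CovariantDerivative 𝓘(ℝ, E) E (fun p : M ↦ TangentSpace 𝓘(ℝ, E) p))
    (hcovM : IsLeviCivita covM)
    (p : M) (X Y : (p : M) → TangentSpace 𝓘(ℝ, E) p) (hX : SmoothAt X p) (hY : SmoothAt Y p) :
    covDerivφ S f covM X Y p =
        ∑ i, (inner ℝ (inducedφ S f p (X p)) (Y p) • inducedξ S f i p
          - inducedη S f i p (Y p) • inducedφ S f p (X p)) ∧
      secondFundamentalForm covN covM f X (inducedφField S f Y) p =
        S.φ (f p) (secondFundamentalForm covN covM f X Y p) ∧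
      secondFundamentalForm covN covM f (inducedφField S f X) Y p =
        S.φ (f p) (secondFundamentalForm covN covM f X Y p) ∧
      secondFundamentalForm covN covM f (inducedφField S f X) (inducedφField S f Y) p =
        -secondFundamentalForm covN covM f X Y p := by
  have hX := hX.mdifferentiableAt
  have hY := hY.mdifferentiableAt
  have hφX := mdifferentiableAt_inducedφField hf hinv hX
  have hright := secondFundamentalForm_inducedφField_right hS hcovN hcovM hf hinv hX hY
  have hleft : secondFundamentalForm covN covM f (inducedφField S f X) Y p =
      S.φ (f p) (secondFundamentalForm covN covM f X Y p) := by
    rw [secondFundamentalForm_comm hcovN hcovM hf.contMDiff hφX hY,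
      secondFundamentalForm_inducedφField_right hS hcovN hcovM hf hinv hY hX,
      secondFundamentalForm_comm hcovN hcovM hf.contMDiff hY hX]
  refine ⟨hf.injective_mfderiv p ?_, hright, hleft, ?_⟩
  -- Once the normal parts are known to agree they cancel, and `df` is injective on what remains.
  · have h := mfderiv_covDerivφ_add (covM := covM) (X := X) hS hcovN hf hinv hY
    rwa [hright, add_left_inj] at h
  · rw [secondFundamentalForm_inducedφField_right hS hcovN hcovM hf hinv hφX hY, hleft, S.φ_φ]
    simp only [η_secondFundamentalForm hS.almost hcovN hcovM hf hinv hX hY, zero_smul,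
      Finset.sum_const_zero, add_zero]
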